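/- All symmetric monoidal categories here are strict (permutative), with product $+$ and unit $0$ in $A$. For a set $G$, $\mathsf S G$ is the free symmetric strict monoidal category on $G$: its objects are tuples of elements of $G$, its product $;$ is concatenation. For a symmetric strict monoidal category $X$, $\mathsf Q X$ is the symmetric strict monoidal category whose objects are tuples of objects of $X$, and whose morphisms are generated by those of the free symmetric monoidal category on the category $X$ together with adjoined isomorphisms $\mathsf q_{\langle x_i\rangle}\colon \langle x_i\rangle\to(x_1+\cdots+x_n)$, subject to naturality, unity and associativity of $\mathsf q$ and to $\mathsf q_{(x)}=1_{(x)}$; every symmetric strong monoidal functor $f\colon X\to Y$ has a mate $f^\bot\colon\mathsf QX\to Y$, a symmetric strict monoidal functor with $\langle x_i\rangle\mapsto f(x_1)+\cdots+f(x_n)$, equal to $f$ on the morphisms of $X$, and sending $\mathsf q$ to the iterated monoidal constraints of $f$. For a function $\phi\colon G\to G'$, let $\mathsf S(G',\phi)$ be the pushout, among symmetric strict monoidal categories and symmetric strict monoidal functors, of $\mathsf S\phi\colon\mathsf SG\to\mathsf SG'$ and $\zeta^\flat\colon\mathsf SG\to\mathsf Q\mathsf SG$, $\langle a_i\rangle\mapsto\langle(a_i)\rangle$,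 with structure functors $\kappa\colon\mathsf SG'\to\mathsf S(G',\phi)$ and $\widehat\phi\colon\mathsf Q\mathsf SG\to\mathsf S(G',\phi)$. Write $\langle[\phi]w_j\rangle_j=\widehat\phi\langle w_j\rangle_j$ for tuples $w_j$ in $G$. The generating morphisms of $\mathsf S(G',\phi)$ are the free morphisms (the image of $\kappa$), the $\phi$-morphisms (the image of $\widehat\phi$), and the formal morphisms (those built from the symmetries of $;$). Let $A=\mathsf S\{a,b\}$. Let $f\colon A\to A$, $f(x)=x+x$, be the doubling functor, with $f_0=1$ and $f_2=1_x+\beta_{x,y}+1_y\colon f(x)+f(y)\to f(x+y)$, and let $h=f\circ f$, a symmetric strong monoidal functor with $h(x)=x+x+x+x$. Let $\phi=h_{\mathsf{ob}}\colon\mathsf{ob}A\to\mathsf{ob}A$ be the object function of $h$, and let $\Lambda\colon\mathsf S(\mathsf{ob}A,\phi)\to A$ be the symmetric strict monoidal functor such that $\Lambda\kappa$ is the sum functor $\mathsf S(\mathsf{ob}A)\to A$ and $\Lambda\widehat\phi$ is the composite $\mathsf Q\mathsf S(\mathsf{ob}A)\to\mathsf QA\xrightarrow{h^\bot}A$. Let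 $\gamma_x=\beta_{x,x+x+x}\colon h(x)\to h(x)$ be the cyclic braiding. Its monoidal naturality diagram at the generating objects $a,b$ has six vertices, two horizontal edges $\gamma_a+\gamma_b\colon h(a)+h(b)\to h(a)+h(b)$ (top) and $\gamma_{a+b}\colon h(a+b)\to h(a+b)$ (bottom), and two equal vertical sides (left and right) \[ h(a)+h(b)\xrightarrow{\;1+\beta_{a+a,b+b}+1\;}a+a+b+b+a+a+b+b\xrightarrow{\;1+\beta_{a,b}+1+1+\beta_{a,b}+1\;}h(a+b), \] whose composite is the monoidal constraint of $h$. An object of $\mathsf S(\mathsf{ob}A,\phi)$ is \emph{tidy} if it has no $;$ factor of the form $\bigl([\phi](0,\ldots,0)\bigr)$ with $n\ge 0$ zeros. A composite $x_0\xrightarrow{\xi_1}x_1\to\cdots\xrightarrow{\xi_r}x_r$ with $r\ge1$ in $\mathsf S(\mathsf{ob}A,\phi)$ is \emph{tidy} if each $x_i$ is tidy and each $\xi_i$ is a $;$ product of generating morphisms. Then every tidy lift of this diagram along $\Lambda$ reduces to an $A$-formal lift. That is: (1) If $x_0\xrightarrow{\xi_1}\cdots\xrightarrow{\xi_r}x_r$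 is a tidy composite such that $\Lambda(\xi_r\cdots\xi_1)$ is the left-bottom or the top-right composite of the diagram, then the sequence $(\xi_1,\ldots,\xi_r)$ factors through $\kappa$: it is the image under $\kappa$ of a sequence of $r$ composable morphisms of $\mathsf S(\mathsf{ob}A)$. (2) Let $D\colon\mathbb D\to A$ be the diagram, as a functor on the free category $\mathbb D$ on its six vertices and six edges, and let $\widetilde D\colon\mathbb D\to\mathsf S(\mathsf{ob}A,\phi)$ be a functor with $\Lambda\widetilde D=D$ that sends each edge to a tidy composite. Then there is a functor $D'\colon\mathbb D\to\mathsf S(\mathsf{ob}A)$ with $\kappa D'=\widetilde D$, and the composite of $D'$ with the sum functor $\mathsf S(\mathsf{ob}A)\to A$ is $D$. -/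

import Mathlib

set_option linter.unusedSectionVars false
open CategoryTheory MonoidalCategory

universe v u v₁ u₁ v₂ u₂ v₃ u₃

/-- A monoidal category is strict if its product is strictly associative and unital, with
identities as associators and unitors. -/
class StrictMonoidal (C : Type u) [Category.{v} C] [MonoidalCategory C] : Prop where
  tensor_assoc : ∀ X Y Z : C, (X ⊗ Y) ⊗ Z = X ⊗ (Y ⊗ Z)
  unit_tensor : ∀ X : C, 𝟙_ C ⊗ X = X
  tensor_unit : ∀ X : C, X ⊗ 𝟙_ C = X
  associator_hom : ∀ X Y Z : C, (α_ X Y Z).hom = eqToHom (tensor_assoc X Y Z)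
  leftUnitor_hom : ∀ X : C, (λ_ X).hom = eqToHom (unit_tensor X)
  rightUnitor_hom : ∀ X : C, (ρ_ X).hom = eqToHom (tensor_unit X)

/-- A functor between symmetric strict monoidal categories is a symmetric strict monoidal functor
if it preserves units, products and symmetries on the nose. -/
structure IsStrictSymmetric {C : Type u₁} [Category.{v₁} C] [MonoidalCategory C]
    [SymmetricCategory C] {D : Type u₂} [Category.{v₂} D] [MonoidalCategory D]
    [SymmetricCategory D] (F : C ⥤ D) : Prop where
  obj_unit : F.obj (𝟙_ C) = 𝟙_ D
  obj_tensor : ∀ X Y : C, F.obj (X ⊗ Y) = F.obj X ⊗ F.obj Y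
  map_tensor : ∀ {X Y X' Y' : C} (f : X ⟶ Y) (g : X' ⟶ Y'),
    HEq (F.map (f ⊗ₘ g)) (F.map f ⊗ₘ F.map g)
  map_braiding : ∀ X Y : C, HEq (F.map (β_ X Y).hom) (β_ (F.obj X) (F.obj Y)).hom

namespace StrictMonoidal

variable {C : Type u} [Category.{v} C] [MonoidalCategory C]

theorem heq_tensor {X Y X' Y' Z W Z' W' : C} {f : X ⟶ Y} {f' : X' ⟶ Y'} {g : Z ⟶ W}
    {g' : Z' ⟶ W'} (hX : X = X') (hY : Y = Y') (hZ : Z = Z') (hW : W = W')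
    (hf : HEq f f') (hg : HEq g g') : HEq (f ⊗ₘ g) (f' ⊗ₘ g') := by
  subst hX hY hZ hW; obtain rfl := eq_of_heq hf; obtain rfl := eq_of_heq hg; rfl

theorem heq_comp' {X Y X' Y' Z Z' : C} {f : X ⟶ Y} {f' : X' ⟶ Y'} {g : Y ⟶ Z}
    {g' : Y' ⟶ Z'} (hX : X = X') (hY : Y = Y') (hZ : Z = Z')
    (hf : HEq f f') (hg : HEq g g') : HEq (f ≫ g) (f' ≫ g') := by
  subst hX hY hZ; obtain rfl := eq_of_heq hf; obtain rfl := eq_of_heq hg; rfl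

theorem heq_braiding [BraidedCategory C] {X Y X' Y' : C} (hX : X = X') (hY : Y = Y') :
    HEq (β_ X Y).hom (β_ X' Y').hom := by
  subst hX hY; rfl

theorem heq_id {X X' : C} (hX : X = X') : HEq (𝟙 X) (𝟙 X') := by
  subst hX; rfl

theorem heq_eqToHom {X X' Y : C} (h : X = X') (hY : X = Y) : HEq (eqToHom h) (𝟙 Y) := by
  subst h hY; rfl

theorem conj_heq {X Y X' Y' : C} (h : X' = X) (f : X ⟶ Y) (h' : Y = Y') :
    HEq (eqToHom h ≫ f ≫ eqToHom h') f := by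
  subst h h'; simp

variable [StrictMonoidal C]

theorem tensor_assoc_heq {X Y X' Y' X'' Y'' : C} (f : X ⟶ Y) (g : X' ⟶ Y') (h : X'' ⟶ Y'') :
    HEq ((f ⊗ₘ g) ⊗ₘ h) (f ⊗ₘ (g ⊗ₘ h)) := by
  have := associator_naturality f g h
  rw [associator_hom, associator_hom] at this
  exact (comp_eqToHom_heq _ _).symm.trans ((heq_of_eq this).trans (eqToHom_comp_heq _ _))

theorem unit_tensor_heq {X Y : C} (f : X ⟶ Y) : HEq (𝟙 (𝟙_ C) ⊗ₘ f) f := by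
  have := leftUnitor_naturality f
  rw [leftUnitor_hom, leftUnitor_hom] at this
  rw [id_tensorHom]
  exact (comp_eqToHom_heq _ _).symm.trans ((heq_of_eq this).trans (eqToHom_comp_heq _ _))

theorem tensor_unit_heq {X Y : C} (f : X ⟶ Y) : HEq (f ⊗ₘ 𝟙 (𝟙_ C)) f := by
  have := rightUnitor_naturality f
  rw [rightUnitor_hom, rightUnitor_hom] at this
  rw [tensorHom_id]
  exact (comp_eqToHom_heq _ _).symm.trans ((heq_of_eq this).trans (eqToHom_comp_heq _ _))

theorem hexagon_heq [BraidedCategory C] (X Y Z : C) :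
    HEq (β_ X (Y ⊗ Z)).hom (((β_ X Y).hom ⊗ₘ 𝟙 Z) ≫
      eqToHom (tensor_assoc Y X Z) ≫ (𝟙 Y ⊗ₘ (β_ X Z).hom)) := by
  have := BraidedCategory.hexagon_forward X Y Z
  rw [associator_hom, associator_hom, associator_hom] at this
  rw [tensorHom_id, id_tensorHom, ← this]
  exact (conj_heq _ _ _).symm

end StrictMonoidal

namespace IsStrictSymmetric

variable {C : Type u₁} [Category.{v₁} C] [MonoidalCategory C] [SymmetricCategory C]
  {D : Type u₂} [Category.{v₂} D] [MonoidalCategory D] [SymmetricCategory D]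
  {E : Type u₃} [Category.{v₃} E] [MonoidalCategory E] [SymmetricCategory E]

theorem map_heq (F : C ⥤ D) {X Y X' Y' : C} {f : X ⟶ Y} {f' : X' ⟶ Y'} (hX : X = X')
    (hY : Y = Y') (h : HEq f f') : HEq (F.map f) (F.map f') := by
  subst hX hY; obtain rfl := eq_of_heq h; rfl

theorem comp {F : C ⥤ D} {G : D ⥤ E} (hF : IsStrictSymmetric F) (hG : IsStrictSymmetric G) :
    IsStrictSymmetric (F ⋙ G) where
  obj_unit := by simp [hF.obj_unit, hG.obj_unit]
  obj_tensor X Y := by simp [hF.obj_tensor, hG.obj_tensor]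
  map_tensor f g := (map_heq G (hF.obj_tensor _ _) (hF.obj_tensor _ _)
    (hF.map_tensor f g)).trans (hG.map_tensor _ _)
  map_braiding X Y := (map_heq G (hF.obj_tensor _ _) (hF.obj_tensor _ _)
    (hF.map_braiding X Y)).trans (hG.map_braiding _ _)

/-- A symmetric strict monoidal functor is a symmetric strong monoidal functor with identity
constraints. -/
@[reducible]
def braided [StrictMonoidal C] [StrictMonoidal D] {F : C ⥤ D} (hF : IsStrictSymmetric F) :
    F.Braided :=
  letI core : F.CoreMonoidal :=
    { εIso := eqToIso hF.obj_unit.symm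
      μIso := fun X Y => eqToIso (hF.obj_tensor X Y).symm
      μIso_hom_natural_left := by
        intro X Y f X'
        apply eq_of_heq
        simp only [eqToIso.hom]
        refine (comp_eqToHom_heq _ _).trans (HEq.trans ?_ (eqToHom_comp_heq _ _).symm)
        rw [← tensorHom_id, ← tensorHom_id, ← F.map_id]
        exact (hF.map_tensor f (𝟙 X')).symm
      μIso_hom_natural_right := by
        intro X Y X' f
        apply eq_of_heq
        simp only [eqToIso.hom]
        refine (comp_eqToHom_heq _ _).trans (HEq.trans ?_ (eqToHom_comp_heq _ _).symm)
        rw [← id_tensorHom, ← id_tensorHom, ← F.map_id]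
        exact (hF.map_tensor (𝟙 X') f).symm
      associativity := by
        intro X Y Z
        simp [StrictMonoidal.associator_hom, eqToHom_map]
      left_unitality := by
        intro X
        simp [StrictMonoidal.leftUnitor_hom, eqToHom_map]
      right_unitality := by
        intro X
        simp [StrictMonoidal.rightUnitor_hom, eqToHom_map] }
  { core.toMonoidal with
    braided := by
      intro X Y
      apply eq_of_heq
      exact (eqToHom_comp_heq _ (hF.obj_tensor X Y).symm).trans
        ((hF.map_braiding X Y).trans (comp_eqToHom_heq _ (hF.obj_tensor Y X).symm).symm) }

end IsStrictSymmetric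

/-! ### Presentations -/

/-- Formal expressions for morphisms between words (lists) in `L`, built from generators by
identities, composition, concatenation and symmetries. -/
inductive SymTerm {L : Type u} (Gen : List L → List L → Type u) : List L → List L → Type u
  | gen {x y : List L} (g : Gen x y) : SymTerm Gen x y
  | id (x : List L) : SymTerm Gen x x
  | comp {x y z : List L} (f : SymTerm Gen x y) (g : SymTerm Gen y z) : SymTerm Gen x z
  | tensor {x y x' y' : List L} (f : SymTerm Gen x y) (g : SymTerm Gen x' y') :
      SymTerm Gen (x ++ x') (y ++ y')
  | braid (x y : List L) : SymTerm Gen (x ++ y) (y ++ x)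

/-- The identity, regarded as a formal morphism between two equal words. -/
def SymTerm.ofEq {L : Type u} {Gen : List L → List L → Type u} {x y : List L} (h : x = y) :
    SymTerm Gen x y :=
  h ▸ SymTerm.id x

/-- Families of relations between formal morphisms (whose end points may be only propositionally
equal). -/
abbrev SymTermRel {L : Type u} (Gen : List L → List L → Type u) : Type u :=
  ∀ ⦃x y x' y' : List L⦄, SymTerm Gen x y → SymTerm Gen x' y' → Prop

/-- The congruence generated by the relations `R` and the axioms of a symmetric strict monoidal
category. -/
inductive SymTerm.Equiv {L : Type u} {Gen : List L → List L → Type u} (R : SymTermRel Gen) :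
    ∀ {x y x' y' : List L}, SymTerm Gen x y → SymTerm Gen x' y' → Prop
  | of {x y x' y' : List L} {f : SymTerm Gen x y} {g : SymTerm Gen x' y'} (hx : x = x')
      (hy : y = y') (h : R f g) : Equiv R f g
  | refl {x y : List L} (f : SymTerm Gen x y) : Equiv R f f
  | symm {x y x' y' : List L} {f : SymTerm Gen x y} {g : SymTerm Gen x' y'} (h : Equiv R f g) :
      Equiv R g f
  | trans {x y x' y' x'' y'' : List L} {f : SymTerm Gen x y} {g : SymTerm Gen x' y'}
      {h : SymTerm Gen x'' y''} (h₁ : Equiv R f g) (h₂ : Equiv R g h) : Equiv R f h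
  | comp_congr {x y z x' y' z' : List L} {f : SymTerm Gen x y} {g : SymTerm Gen y z}
      {f' : SymTerm Gen x' y'} {g' : SymTerm Gen y' z'} (hf : Equiv R f f') (hg : Equiv R g g') :
      Equiv R (f.comp g) (f'.comp g')
  | tensor_congr {x y z w x' y' z' w' : List L} {f : SymTerm Gen x y} {g : SymTerm Gen z w}
      {f' : SymTerm Gen x' y'} {g' : SymTerm Gen z' w'} (hf : Equiv R f f') (hg : Equiv R g g') :
      Equiv R (f.tensor g) (f'.tensor g')
  | id_comp {x y : List L} (f : SymTerm Gen x y) : Equiv R ((SymTerm.id x).comp f) f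
  | comp_id {x y : List L} (f : SymTerm Gen x y) : Equiv R (f.comp (SymTerm.id y)) f
  | comp_assoc {x y z w : List L} (f : SymTerm Gen x y) (g : SymTerm Gen y z)
      (h : SymTerm Gen z w) : Equiv R ((f.comp g).comp h) (f.comp (g.comp h))
  | tensor_id (x y : List L) :
      Equiv R ((SymTerm.id x).tensor (SymTerm.id y)) (SymTerm.id (x ++ y))
  | tensor_comp {x y z x' y' z' : List L} (f : SymTerm Gen x y) (g : SymTerm Gen y z)
      (f' : SymTerm Gen x' y') (g' : SymTerm Gen y' z') :
      Equiv R ((f.comp g).tensor (f'.comp g')) ((f.tensor f').comp (g.tensor g'))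
  | tensor_assoc {x y x' y' x'' y'' : List L} (f : SymTerm Gen x y) (g : SymTerm Gen x' y')
      (h : SymTerm Gen x'' y'') : Equiv R ((f.tensor g).tensor h) (f.tensor (g.tensor h))
  | unit_tensor {x y : List L} (f : SymTerm Gen x y) : Equiv R ((SymTerm.id []).tensor f) f
  | tensor_unit {x y : List L} (f : SymTerm Gen x y) : Equiv R (f.tensor (SymTerm.id [])) f
  | braid_natural {x y x' y' : List L} (f : SymTerm Gen x y) (g : SymTerm Gen x' y') :
      Equiv R ((f.tensor g).comp (SymTerm.braid y y')) ((SymTerm.braid x x').comp (g.tensor f))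
  | braid_symm (x y : List L) :
      Equiv R ((SymTerm.braid x y).comp (SymTerm.braid y x)) (SymTerm.id (x ++ y))
  | hexagon (x y z : List L) :
      Equiv R (SymTerm.braid x (y ++ z))
        (((SymTerm.braid x y).tensor (SymTerm.id z)).comp
          ((SymTerm.ofEq (List.append_assoc y x z)).comp
            ((SymTerm.id y).tensor (SymTerm.braid x z))))

/-- A presentation of a symmetric strict monoidal category whose monoid of objects is free:
an alphabet, generating morphisms between words, and relations. -/
structure SymPresentation where
  Letter : Type u
  Gen : List Letter → List Letter → Type u
  Rel : SymTermRel Gen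

namespace SymPresentation

variable (p : SymPresentation.{u})

/-- The symmetric strict monoidal category presented by `p`: its objects are words. -/
def Cat : Type u := List p.Letter

variable {p}

theorem equiv_ends {x y x' y' : List p.Letter} {f : SymTerm p.Gen x y} {g : SymTerm p.Gen x' y'}
    (h : SymTerm.Equiv p.Rel f g) : x = x' ∧ y = y' := by
  induction h with
  | of hx hy _ => exact ⟨hx, hy⟩
  | symm _ ih => exact ⟨ih.1.symm, ih.2.symm⟩
  | trans _ _ ih₁ ih₂ => exact ⟨ih₁.1.trans ih₂.1, ih₁.2.trans ih₂.2⟩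
  | comp_congr _ _ ih₁ ih₂ => exact ⟨ih₁.1, ih₂.2⟩
  | tensor_congr _ _ ih₁ ih₂ => exact ⟨by rw [ih₁.1, ih₂.1], by rw [ih₁.2, ih₂.2]⟩
  | _ => simp

/-- Morphisms are formal morphisms modulo the generated congruence. -/
def Hom (x y : List p.Letter) : Type u :=
  Quot fun f g : SymTerm p.Gen x y => SymTerm.Equiv p.Rel f g

/-- The class of a formal morphism. -/
def toHom {x y : List p.Letter} (f : SymTerm p.Gen x y) : Hom x y := Quot.mk _ f

theorem toHom_heq {x y x' y' : List p.Letter} {f : SymTerm p.Gen x y} {g : SymTerm p.Gen x' y'}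
    (h : SymTerm.Equiv p.Rel f g) : HEq (toHom f) (toHom g) := by
  obtain ⟨rfl, rfl⟩ := equiv_ends h
  exact heq_of_eq (Quot.sound h)

theorem toHom_eq {x y : List p.Letter} {f g : SymTerm p.Gen x y}
    (h : SymTerm.Equiv p.Rel f g) : toHom f = toHom g :=
  Quot.sound h

instance : Category.{u} p.Cat where
  Hom x y := Hom (p := p) x y
  id x := toHom (SymTerm.id x)
  comp f g := Quot.map₂ SymTerm.comp
    (fun _ _ _ h => SymTerm.Equiv.comp_congr (.refl _) h)
    (fun _ _ _ h => SymTerm.Equiv.comp_congr h (.refl _)) f g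
  id_comp := by rintro _ _ ⟨f⟩; exact Quot.sound (.id_comp f)
  comp_id := by rintro _ _ ⟨f⟩; exact Quot.sound (.comp_id f)
  assoc := by rintro _ _ _ _ ⟨f⟩ ⟨g⟩ ⟨h⟩; exact Quot.sound (.comp_assoc f g h)

/-- The morphism named by a formal morphism. -/
def homMk {x y : p.Cat} (f : SymTerm p.Gen x y) : x ⟶ y := toHom f

theorem homMk_heq {x y x' y' : p.Cat} {f : SymTerm p.Gen x y} {g : SymTerm p.Gen x' y'}
    (h : SymTerm.Equiv p.Rel f g) : HEq (homMk (p := p) f) (homMk (p := p) g) := toHom_heq h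

theorem homMk_eq {x y : p.Cat} {f g : SymTerm p.Gen x y}
    (h : SymTerm.Equiv p.Rel f g) : homMk (p := p) f = homMk (p := p) g := toHom_eq h

theorem homMk_surjective {x y : p.Cat} (f : x ⟶ y) : ∃ t : SymTerm p.Gen x y, homMk t = f :=
  Quot.exists_rep f

theorem homMk_ofEq {x y : p.Cat} (h : x = y) :
    homMk (p := p) (SymTerm.ofEq h) = eqToHom h := by
  subst h; rfl

/-- Concatenation of morphisms. -/
def tensorHom' {x y x' y' : p.Cat} (f : x ⟶ y) (g : x' ⟶ y') :
    (show p.Cat from List.append x x') ⟶ (show p.Cat from List.append y y') :=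
  Quot.map₂ SymTerm.tensor
    (fun _ _ _ h => SymTerm.Equiv.tensor_congr (.refl _) h)
    (fun _ _ _ h => SymTerm.Equiv.tensor_congr h (.refl _)) f g

theorem append_assoc' (x y z : p.Cat) :
    (show p.Cat from List.append (List.append x y) z) = List.append x (List.append y z) :=
  List.append_assoc x y z

theorem append_nil' (x : p.Cat) : (show p.Cat from List.append x []) = x :=
  List.append_nil x

instance : MonoidalCategoryStruct p.Cat where
  tensorObj x y := List.append x y
  tensorUnit := ([] : List p.Letter)
  tensorHom f g := tensorHom' f g
  whiskerLeft x _ _ f := tensorHom' (𝟙 x) f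
  whiskerRight f y := tensorHom' f (𝟙 y)
  associator x y z := eqToIso (append_assoc' x y z)
  leftUnitor x := eqToIso rfl
  rightUnitor x := eqToIso (append_nil' x)

theorem isEq_unique {x y : p.Cat} {f g : x ⟶ y} (hf : ∃ h, f = eqToHom h)
    (hg : ∃ h, g = eqToHom h) : f = g := by
  obtain ⟨_, rfl⟩ := hf
  obtain ⟨_, rfl⟩ := hg
  rfl

theorem isEq_comp {x y z : p.Cat} {f : x ⟶ y} {g : y ⟶ z} (hf : ∃ h, f = eqToHom h)
    (hg : ∃ h, g = eqToHom h) : ∃ h, f ≫ g = eqToHom h := by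
  obtain ⟨rfl, rfl⟩ := hf
  obtain ⟨rfl, rfl⟩ := hg
  exact ⟨rfl, Category.id_comp _⟩

theorem isEq_tensor {x y x' y' : p.Cat} {f : x ⟶ y} {g : x' ⟶ y'} (hf : ∃ h, f = eqToHom h)
    (hg : ∃ h, g = eqToHom h) : ∃ h, (f ⊗ₘ g) = eqToHom h := by
  obtain ⟨rfl, rfl⟩ := hf
  obtain ⟨rfl, rfl⟩ := hg
  exact ⟨rfl, homMk_eq (.tensor_id x x')⟩

theorem heq_comp_eqToHom {x y z : p.Cat} (f : x ⟶ y) (h : y = z) : HEq (f ≫ eqToHom h) f := by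
  subst h; simp

theorem heq_eqToHom_comp {x y z : p.Cat} (h : x = y) (f : y ⟶ z) : HEq (eqToHom h ≫ f) f := by
  subst h; simp

instance : MonoidalCategory p.Cat :=
  MonoidalCategory.ofTensorHom
    (id_tensorHom_id := fun x y => homMk_eq (.tensor_id x y))
    (id_tensorHom := fun _ _ _ _ => rfl)
    (tensorHom_id := fun _ _ => rfl)
    (tensorHom_comp_tensorHom := by
      rintro _ _ _ _ _ _ ⟨f⟩ ⟨f'⟩ ⟨g⟩ ⟨g'⟩
      exact homMk_eq (.symm (.tensor_comp f g f' g')))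
    (associator_naturality := by
      rintro x₁ x₂ x₃ y₁ y₂ y₃ ⟨f⟩ ⟨g⟩ ⟨h⟩
      exact eq_of_heq ((heq_comp_eqToHom _ (append_assoc' y₁ y₂ y₃)).trans
        ((homMk_heq (.tensor_assoc f g h)).trans
          (heq_eqToHom_comp (append_assoc' x₁ x₂ x₃) _).symm)))
    (leftUnitor_naturality := by
      rintro x y ⟨f⟩
      exact eq_of_heq ((heq_comp_eqToHom (p := p) (z := y) _ rfl).trans
        ((homMk_heq (.unit_tensor f)).trans (heq_eqToHom_comp (p := p) (x := x) rfl _).symm)))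
    (rightUnitor_naturality := by
      rintro x y ⟨f⟩
      exact eq_of_heq ((heq_comp_eqToHom _ (append_nil' y)).trans
        ((homMk_heq (.tensor_unit f)).trans (heq_eqToHom_comp (append_nil' x) _).symm)))
    (pentagon := by
      intro w x y z
      exact isEq_unique
        (isEq_comp (isEq_tensor ⟨append_assoc' w x y, rfl⟩ ⟨rfl, rfl⟩)
          (isEq_comp ⟨append_assoc' w (x ⊗ y) z, rfl⟩
            (isEq_tensor ⟨rfl, rfl⟩ ⟨append_assoc' x y z, rfl⟩)))
        (isEq_comp ⟨append_assoc' (w ⊗ x) y z, rfl⟩ ⟨append_assoc' w x (y ⊗ z), rfl⟩))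
    (triangle := by
      intro x y
      exact isEq_unique
        (isEq_comp ⟨append_assoc' x (𝟙_ p.Cat) y, rfl⟩ (isEq_tensor ⟨rfl, rfl⟩ ⟨rfl, rfl⟩))
        (isEq_tensor ⟨append_nil' x, rfl⟩ ⟨rfl, rfl⟩))

instance : StrictMonoidal p.Cat where
  tensor_assoc := append_assoc'
  unit_tensor _ := rfl
  tensor_unit := append_nil'
  associator_hom _ _ _ := rfl
  leftUnitor_hom _ := rfl
  rightUnitor_hom _ := rfl

/-- The symmetry exchanging two words. -/
def braidIso (x y : p.Cat) : x ⊗ y ≅ y ⊗ x where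
  hom := homMk (SymTerm.braid x y)
  inv := homMk (SymTerm.braid y x)
  hom_inv_id := homMk_eq (.braid_symm x y)
  inv_hom_id := homMk_eq (.braid_symm y x)

theorem braid_natural' {x y x' y' : p.Cat} (f : x ⟶ y) (g : x' ⟶ y') :
    (f ⊗ₘ g) ≫ (braidIso y y').hom = (braidIso x x').hom ≫ (g ⊗ₘ f) := by
  obtain ⟨f, rfl⟩ := homMk_surjective f
  obtain ⟨g, rfl⟩ := homMk_surjective g
  exact homMk_eq (.braid_natural f g)

theorem hexagon' (x y z : p.Cat) :
    (α_ x y z).hom ≫ (braidIso x (y ⊗ z)).hom ≫ (α_ y z x).hom =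
      ((braidIso x y).hom ▷ z) ≫ (α_ y x z).hom ≫ (y ◁ (braidIso x z).hom) := by
  apply eq_of_heq
  refine (StrictMonoidal.conj_heq (append_assoc' x y z) (braidIso x (y ⊗ z)).hom
    (append_assoc' y z x)).trans ?_
  have h1 := homMk_heq (p := p) (.hexagon x y z)
  refine h1.trans (heq_of_eq ?_)
  have h2 : (α_ y x z).hom = homMk (p := p) (SymTerm.ofEq (append_assoc' y x z)) :=
    (homMk_ofEq _).symm
  rw [h2]
  rfl

instance : SymmetricCategory p.Cat where
  braiding := braidIso
  braiding_naturality_right := by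
    intro x y z f
    rw [← id_tensorHom, ← tensorHom_id]; exact braid_natural' _ _
  braiding_naturality_left := by
    intro x y f z
    rw [← id_tensorHom, ← tensorHom_id]; exact braid_natural' _ _
  hexagon_forward := hexagon'
  hexagon_reverse := by
    intro x y z
    have h := hexagon' z x y
    have h' : (α_ z x y) ≪≫ braidIso z (x ⊗ y) ≪≫ (α_ x y z) =
        whiskerRightIso (braidIso z x) y ≪≫ (α_ x z y) ≪≫ whiskerLeftIso x (braidIso z y) :=
      Iso.ext h
    have h'' := congrArg Iso.inv h'
    simp only [Iso.trans_inv, whiskerRightIso_inv, whiskerLeftIso_inv, Category.assoc] at h''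
    exact h''
  symmetry x y := (braidIso x y).hom_inv_id

end SymPresentation

/-! ### Functors out of presented categories -/

section Lift

variable {C : Type u₁} [Category.{v₁} C] [MonoidalCategory C] [SymmetricCategory C]
  [StrictMonoidal C]

/-- The product of a word of objects: `listProd o [l₁, …, lₙ] = o l₁ ⊗ (⋯ ⊗ (o lₙ ⊗ 𝟙_ C))`. -/
def listProd {L : Type u} (o : L → C) : List L → C
  | [] => 𝟙_ C
  | l :: x => o l ⊗ listProd o x

theorem listProd_append {L : Type u} (o : L → C) (x y : List L) :
    listProd o (x ++ y) = listProd o x ⊗ listProd o y := by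
  induction x with
  | nil => exact (StrictMonoidal.unit_tensor _).symm
  | cons l x ih =>
    change o l ⊗ listProd o (x ++ y) = (o l ⊗ listProd o x) ⊗ listProd o y
    rw [ih, StrictMonoidal.tensor_assoc]

/-- Evaluation of a formal morphism in a symmetric strict monoidal category. -/
def SymTerm.eval {L : Type u} {Gen : List L → List L → Type u} (o : L → C)
    (g : ∀ x y : List L, Gen x y → (listProd o x ⟶ listProd o y)) :
    ∀ {x y : List L}, SymTerm Gen x y → (listProd o x ⟶ listProd o y)
  | _, _, .gen s => g _ _ s
  | _, _, .id x => 𝟙 (listProd o x)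
  | _, _, .comp s t => s.eval o g ≫ t.eval o g
  | _, _, .tensor s t =>
      eqToHom (listProd_append o _ _) ≫ (s.eval o g ⊗ₘ t.eval o g) ≫
        eqToHom (listProd_append o _ _).symm
  | _, _, .braid x y =>
      eqToHom (listProd_append o x y) ≫ (β_ (listProd o x) (listProd o y)).hom ≫
        eqToHom (listProd_append o y x).symm

namespace SymTerm

variable {L : Type u} {Gen : List L → List L → Type u} (o : L → C)
    (g : ∀ x y : List L, Gen x y → (listProd o x ⟶ listProd o y))

theorem eval_tensor_heq {x y x' y' : List L} (s : SymTerm Gen x y) (t : SymTerm Gen x' y') :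
    HEq ((s.tensor t).eval o g) (s.eval o g ⊗ₘ t.eval o g) :=
  StrictMonoidal.conj_heq _ _ _

theorem eval_braid_heq (x y : List L) :
    HEq ((SymTerm.braid (Gen := Gen) x y).eval o g) (β_ (listProd o x) (listProd o y)).hom :=
  StrictMonoidal.conj_heq _ _ _

theorem eval_ofEq {x y : List L} (h : x = y) :
    (SymTerm.ofEq (Gen := Gen) h).eval o g = eqToHom (congrArg (listProd o) h) := by
  subst h; rfl

theorem Equiv.ends {R : SymTermRel Gen} {x y x' y' : List L} {f : SymTerm Gen x y}
    {f' : SymTerm Gen x' y'} (h : SymTerm.Equiv R f f') : x = x' ∧ y = y' :=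
  SymPresentation.equiv_ends (p := ⟨L, Gen, R⟩) h

theorem eval_heq {R : SymTermRel Gen}
    (hR : ∀ ⦃x y x' y' : List L⦄ (f : SymTerm Gen x y) (f' : SymTerm Gen x' y'), R f f' →
      x = x' → y = y' → HEq (f.eval o g) (f'.eval o g))
    {x y x' y' : List L} {f : SymTerm Gen x y} {f' : SymTerm Gen x' y'}
    (h : SymTerm.Equiv R f f') : HEq (f.eval o g) (f'.eval o g) := by
  have E : ∀ {x y : List L}, x = y → listProd o x = listProd o y := fun h => congrArg _ h
  have A : ∀ x y : List L, listProd o (x ++ y) = listProd o x ⊗ listProd o y :=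
    listProd_append o
  induction h with
  | of hx hy h => exact hR _ _ h hx hy
  | refl f => exact HEq.rfl
  | symm _ ih => exact ih.symm
  | trans _ _ ih₁ ih₂ => exact ih₁.trans ih₂
  | comp_congr h₁ h₂ ih₁ ih₂ =>
    exact StrictMonoidal.heq_comp' (E h₁.ends.1) (E h₁.ends.2) (E h₂.ends.2) ih₁ ih₂
  | tensor_congr h₁ h₂ ih₁ ih₂ =>
    exact (eval_tensor_heq o g _ _).trans ((StrictMonoidal.heq_tensor (E h₁.ends.1)
      (E h₁.ends.2) (E h₂.ends.1) (E h₂.ends.2) ih₁ ih₂).trans (eval_tensor_heq o g _ _).symm)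
  | id_comp f => exact heq_of_eq (Category.id_comp _)
  | comp_id f => exact heq_of_eq (Category.comp_id _)
  | comp_assoc f g h => exact heq_of_eq (Category.assoc _ _ _)
  | tensor_id x y =>
    refine (eval_tensor_heq o g _ _).trans ?_
    change HEq (𝟙 (listProd o x) ⊗ₘ 𝟙 (listProd o y)) (𝟙 (listProd o (x ++ y)))
    rw [id_tensorHom_id]
    exact StrictMonoidal.heq_id (A x y).symm
  | tensor_comp f f' k k' =>
    refine (eval_tensor_heq o g _ _).trans ?_
    change HEq ((f.eval o g ≫ f'.eval o g) ⊗ₘ (k.eval o g ≫ k'.eval o g)) _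
    rw [← tensorHom_comp_tensorHom]
    exact (StrictMonoidal.heq_comp' (A _ _) (A _ _) (A _ _) (eval_tensor_heq o g _ _)
      (eval_tensor_heq o g _ _)).symm
  | tensor_assoc f k h =>
    refine (eval_tensor_heq o g _ _).trans ((StrictMonoidal.heq_tensor (A _ _) (A _ _) rfl rfl
      (eval_tensor_heq o g _ _) HEq.rfl).trans ?_)
    refine (StrictMonoidal.tensor_assoc_heq _ _ _).trans ?_
    exact ((eval_tensor_heq o g _ _).trans (StrictMonoidal.heq_tensor rfl rfl (A _ _) (A _ _)
      HEq.rfl (eval_tensor_heq o g _ _))).symm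
  | unit_tensor f => exact (eval_tensor_heq o g _ _).trans (StrictMonoidal.unit_tensor_heq _)
  | tensor_unit f => exact (eval_tensor_heq o g _ _).trans (StrictMonoidal.tensor_unit_heq _)
  | braid_natural f k =>
    refine (StrictMonoidal.heq_comp' (A _ _) (A _ _) (A _ _) (eval_tensor_heq o g _ _)
      (eval_braid_heq o g _ _)).trans ?_
    rw [BraidedCategory.braiding_naturality]
    exact (StrictMonoidal.heq_comp' (A _ _) (A _ _) (A _ _) (eval_braid_heq o g _ _)
      (eval_tensor_heq o g _ _)).symm
  | braid_symm x y =>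
    refine (StrictMonoidal.heq_comp' (A _ _) (A _ _) (A _ _) (eval_braid_heq o g _ _)
      (eval_braid_heq o g _ _)).trans ?_
    rw [SymmetricCategory.symmetry]
    exact StrictMonoidal.heq_id (A x y).symm
  | hexagon x y z =>
    refine (eval_braid_heq o g _ _).trans ((StrictMonoidal.heq_braiding rfl (A y z)).trans
      ((StrictMonoidal.hexagon_heq _ _ _).trans ?_))
    have A3 : listProd o (x ++ y ++ z) = (listProd o x ⊗ listProd o y) ⊗ listProd o z := by
      rw [A, A]
    have A3' : listProd o (y ++ x ++ z) = (listProd o y ⊗ listProd o x) ⊗ listProd o z := by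
      rw [A, A]
    have A4 : listProd o (y ++ (x ++ z)) = listProd o y ⊗ (listProd o x ⊗ listProd o z) := by
      rw [A, A]
    have A5 : listProd o (y ++ (z ++ x)) = listProd o y ⊗ (listProd o z ⊗ listProd o x) := by
      rw [A, A]
    refine (StrictMonoidal.heq_comp' A3 A3' A5 ?_ (StrictMonoidal.heq_comp' A3' A4 A5 ?_ ?_)).symm
    · exact (eval_tensor_heq o g _ _).trans (StrictMonoidal.heq_tensor (A _ _) (A _ _) rfl rfl
        (eval_braid_heq o g _ _) HEq.rfl)
    · rw [eval_ofEq]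
      exact (StrictMonoidal.heq_eqToHom _ rfl).trans ((StrictMonoidal.heq_id A3').trans
        (StrictMonoidal.heq_eqToHom _ rfl).symm)
    · exact (eval_tensor_heq o g _ _).trans (StrictMonoidal.heq_tensor rfl rfl (A _ _) (A _ _)
        HEq.rfl (eval_braid_heq o g _ _))

end SymTerm

namespace SymPresentation

variable {p : SymPresentation.{u}}

/-- The symmetric strict monoidal functor determined by values on letters and on generating
morphisms that respect the relations. -/
def lift (o : p.Letter → C)
    (g : ∀ x y : List p.Letter, p.Gen x y → (listProd o x ⟶ listProd o y))
    (hR : ∀ ⦃x y x' y' : List p.Letter⦄ (f : SymTerm p.Gen x y) (f' : SymTerm p.Gen x' y'),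
      p.Rel f f' → x = x' → y = y' → HEq (f.eval o g) (f'.eval o g)) : p.Cat ⥤ C where
  obj x := listProd o x
  map f := Quot.lift (fun t => t.eval o g)
    (fun _ _ h => eq_of_heq (SymTerm.eval_heq o g hR h)) f
  map_id _ := rfl
  map_comp := by rintro _ _ _ ⟨f⟩ ⟨g⟩; rfl

theorem lift_isStrictSymmetric (o : p.Letter → C)
    (g : ∀ x y : List p.Letter, p.Gen x y → (listProd o x ⟶ listProd o y))
    (hR : ∀ ⦃x y x' y' : List p.Letter⦄ (f : SymTerm p.Gen x y) (f' : SymTerm p.Gen x' y'),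
      p.Rel f f' → x = x' → y = y' → HEq (f.eval o g) (f'.eval o g)) :
    IsStrictSymmetric (lift o g hR) where
  obj_unit := rfl
  obj_tensor := listProd_append o
  map_tensor := by rintro _ _ _ _ ⟨f⟩ ⟨f'⟩; exact SymTerm.eval_tensor_heq o g f f'
  map_braiding := SymTerm.eval_braid_heq o g

/-- Strict functors that agree on letters agree on objects. -/
theorem obj_eq_of_letters {F G : p.Cat ⥤ C} (hF : IsStrictSymmetric F) (hG : IsStrictSymmetric G)
    (h : ∀ l : p.Letter, F.obj ([l] : List p.Letter) = G.obj ([l] : List p.Letter))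
    (x : List p.Letter) : F.obj x = G.obj x := by
  induction x with
  | nil => exact hF.obj_unit.trans hG.obj_unit.symm
  | cons l x ih =>
    exact (hF.obj_tensor ([l] : List p.Letter) x).trans
      ((congrArg₂ (fun a b : C => a ⊗ b) (h l) ih).trans
        (hG.obj_tensor ([l] : List p.Letter) x).symm)

/-- Strict functors that agree on letters and on generating morphisms agree. -/
theorem map_heq_of_letters {F G : p.Cat ⥤ C} (hF : IsStrictSymmetric F)
    (hG : IsStrictSymmetric G)
    (h : ∀ l : p.Letter, F.obj ([l] : List p.Letter) = G.obj ([l] : List p.Letter))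
    (hg : ∀ (x y : List p.Letter) (s : p.Gen x y),
      HEq (F.map (homMk (p := p) (.gen s))) (G.map (homMk (p := p) (.gen s))))
    {x y : p.Cat} (f : x ⟶ y) : HEq (F.map f) (G.map f) := by
  have O := obj_eq_of_letters hF hG h
  obtain ⟨t, rfl⟩ := homMk_surjective f
  induction t with
  | gen s => exact hg _ _ s
  | id x =>
    exact (heq_of_eq (F.map_id _)).trans ((StrictMonoidal.heq_id (O x)).trans
      (heq_of_eq (G.map_id _).symm))
  | comp s t ih₁ ih₂ =>
    exact (heq_of_eq (F.map_comp (homMk (p := p) s) (homMk (p := p) t))).trans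
      ((StrictMonoidal.heq_comp' (O _) (O _) (O _) ih₁ ih₂).trans
        (heq_of_eq (G.map_comp (homMk (p := p) s) (homMk (p := p) t)).symm))
  | tensor s t ih₁ ih₂ =>
    exact (hF.map_tensor (homMk (p := p) s) (homMk (p := p) t)).trans
      ((StrictMonoidal.heq_tensor (O _) (O _) (O _) (O _) ih₁ ih₂).trans
        (hG.map_tensor (homMk (p := p) s) (homMk (p := p) t)).symm)
  | braid x y =>
    exact (hF.map_braiding x y).trans ((StrictMonoidal.heq_braiding (O x) (O y)).trans
      (hG.map_braiding x y).symm)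

end SymPresentation

end Lift

/-! ### Free symmetric strict monoidal categories -/

/-- No generating morphisms and no relations. -/
abbrev freeSymmPresentation (G : Type u) : SymPresentation.{u} where
  Letter := G
  Gen _ _ := PEmpty
  Rel _ _ _ _ _ _ := False

/-- The free symmetric strict monoidal category `S G` on a set `G`. -/
abbrev FreeSymm (G : Type u) : Type u := (freeSymmPresentation G).Cat

namespace FreeSymm

variable {C : Type u₁} [Category.{v₁} C] [MonoidalCategory C] [SymmetricCategory C]
  [StrictMonoidal C] {G G' : Type u}

/-- The tuple with the given entries, as an object of `S G`. -/
def tuple (x : List G) : FreeSymm G := x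

/-- The symmetric strict monoidal functor `S G ⥤ C` extending a function on `G`. -/
def lift (o : G → C) : FreeSymm G ⥤ C :=
  SymPresentation.lift (p := freeSymmPresentation G) o (fun _ _ s => PEmpty.elim s)
    (fun _ _ _ _ _ _ h => False.elim h)

theorem lift_isStrictSymmetric (o : G → C) : IsStrictSymmetric (lift o) :=
  SymPresentation.lift_isStrictSymmetric _ _ _

/-- `S φ : S G ⥤ S G'` for a function `φ : G → G'`. -/
def map (φ : G → G') : FreeSymm G ⥤ FreeSymm G' := lift fun a => tuple [φ a]

variable (C) in
/-- The composite `S (ob C) ⥤ S C ⥤ C` of the functor induced by inclusion of objects and the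
multiplication of `C`. -/
def mult : FreeSymm C ⥤ C := lift fun c => c

end FreeSymm

/-- Morphisms of `C`, as generating morphisms between words of length one. -/
inductive FreeSymmCatGen (C : Type u) [Category.{u} C] : List C → List C → Type u
  | mor {a b : C} (s : a ⟶ b) : FreeSymmCatGen C [a] [b]

/-- The inclusion of `C` is a functor. -/
inductive FreeSymmCatRel (C : Type u) [Category.{u} C] : SymTermRel (FreeSymmCatGen C)
  | mor_id (a : C) : FreeSymmCatRel C (.gen (.mor (𝟙 a))) (.id [a])
  | mor_comp {a b c : C} (s : a ⟶ b) (t : b ⟶ c) :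
      FreeSymmCatRel C (.gen (.mor (s ≫ t))) ((SymTerm.gen (.mor s)).comp (.gen (.mor t)))

/-- Generators and relations for the free symmetric strict monoidal category on `C`. -/
abbrev freeSymmCatPresentation (C : Type u) [Category.{u} C] : SymPresentation.{u} where
  Letter := C
  Gen := FreeSymmCatGen C
  Rel := FreeSymmCatRel C

/-- The free symmetric strict monoidal category `S C` on a category `C`. -/
abbrev FreeSymmCat (C : Type u) [Category.{u} C] : Type u := (freeSymmCatPresentation C).Cat

namespace FreeSymmCat

variable {C : Type u} [Category.{u} C] {D : Type u₁} [Category.{v₁} D] [MonoidalCategory D]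
  [SymmetricCategory D] [StrictMonoidal D]

/-- The tuple with the given entries, as an object of `S C`. -/
def tuple (x : List C) : FreeSymmCat C := x

/-- The inclusion of morphisms of `C` as morphisms between tuples of length one. -/
def unitMap {a b : C} (s : a ⟶ b) : tuple [a] ⟶ tuple [b] :=
  SymPresentation.homMk (p := freeSymmCatPresentation C) (.gen (.mor s))

/-- The symmetric strict monoidal functor `S C ⥤ D` extending a functor `C ⥤ D`. -/
def lift (F : C ⥤ D) : FreeSymmCat C ⥤ D :=
  SymPresentation.lift (p := freeSymmCatPresentation C) F.obj
    (fun _ _ s => match s with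
      | .mor s => F.map s ⊗ₘ 𝟙 (𝟙_ D))
    (by
      rintro _ _ _ _ _ _ (⟨a⟩ | ⟨s, t⟩) _ _
      · change HEq (F.map (𝟙 a) ⊗ₘ 𝟙 (𝟙_ D)) (𝟙 (F.obj a ⊗ 𝟙_ D))
        rw [F.map_id, id_tensorHom_id]
      · change HEq (F.map (s ≫ t) ⊗ₘ 𝟙 (𝟙_ D))
          ((F.map s ⊗ₘ 𝟙 (𝟙_ D)) ≫ (F.map t ⊗ₘ 𝟙 (𝟙_ D)))
        rw [tensorHom_comp_tensorHom, F.map_comp, Category.comp_id])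

theorem lift_isStrictSymmetric (F : C ⥤ D) : IsStrictSymmetric (lift F) :=
  SymPresentation.lift_isStrictSymmetric _ _ _

theorem lift_obj (F : C ⥤ D) (x : List C) : (lift F).obj x = listProd F.obj x := rfl

theorem lift_map_unitMap (F : C ⥤ D) {a b : C} (s : a ⟶ b) :
    (lift F).map (unitMap s) = (F.map s ⊗ₘ 𝟙 (𝟙_ D)) := rfl

variable (C) in
/-- The multiplication `S C ⥤ C` of a symmetric strict monoidal category. -/
def mult [MonoidalCategory C] [SymmetricCategory C] [StrictMonoidal C] : FreeSymmCat C ⥤ C :=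
  lift (𝟭 C)

end FreeSymmCat

/-! ### The pseudomorphism classifier `Q` -/

section PsClassifier

variable (A : Type u) [Category.{u} A] [MonoidalCategory A] [SymmetricCategory A]
  [StrictMonoidal A]

/-- Generating morphisms of `Q A`: the free morphisms, which are the morphisms of `S A`, and the
adjoined isomorphisms from a tuple to the one-entry tuple of its product, with their inverses. -/
inductive PsClassifierGen : List A → List A → Type u
  | free {x y : FreeSymmCat A} (t : x ⟶ y) : PsClassifierGen x y
  | adj (x : List A) : PsClassifierGen x [(FreeSymmCat.mult A).obj x]
  | adjInv (x : List A) : PsClassifierGen [(FreeSymmCat.mult A).obj x] x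

/-- The relations between the generating morphisms of `Q A`. -/
inductive PsClassifierRel : SymTermRel (PsClassifierGen A)
  | free_id (x : FreeSymmCat A) : PsClassifierRel (.gen (.free (𝟙 x))) (.id x)
  | free_comp {x y z : FreeSymmCat A} (s : x ⟶ y) (t : y ⟶ z) :
      PsClassifierRel (.gen (.free (s ≫ t))) ((SymTerm.gen (.free s)).comp (.gen (.free t)))
  | free_tensor {x y x' y' : FreeSymmCat A} (s : x ⟶ y) (t : x' ⟶ y') :
      PsClassifierRel (.gen (.free (s ⊗ₘ t))) ((SymTerm.gen (.free s)).tensor (.gen (.free t)))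
  | free_braiding (x y : FreeSymmCat A) :
      PsClassifierRel (.gen (.free (β_ x y).hom)) (.braid x y)
  | adj_adjInv (x : List A) :
      PsClassifierRel ((SymTerm.gen (.adj x)).comp (.gen (.adjInv x))) (.id x)
  | adjInv_adj (x : List A) :
      PsClassifierRel ((SymTerm.gen (.adjInv x)).comp (.gen (.adj x)))
        (.id [(FreeSymmCat.mult A).obj x])
  | adj_natural {x y : FreeSymmCat A} (t : x ⟶ y) :
      PsClassifierRel ((SymTerm.gen (.free t)).comp (.gen (.adj y)))
        ((SymTerm.gen (.adj x)).comp
          (.gen (.free (FreeSymmCat.unitMap ((FreeSymmCat.mult A).map t)))))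
  | adj_unit (x y : List A) :
      PsClassifierRel
        ((((SymTerm.id x).tensor (.gen (.adj []))).tensor (.id y)).comp
          (.gen (.adj ((x ++ [𝟙_ A]) ++ y))))
        (.gen (.adj (x ++ y)))
  | adj_assoc_right (x y z : List A) :
      PsClassifierRel
        (((SymTerm.id x).tensor (.gen (.adj (y ++ z)))).comp
          (.gen (.adj (x ++ [(FreeSymmCat.mult A).obj (y ++ z)]))))
        (.gen (.adj (x ++ (y ++ z))))
  | adj_assoc_left (x y z : List A) :
      PsClassifierRel
        (((SymTerm.gen (.adj (x ++ y))).tensor (.id z)).comp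
          (.gen (.adj ([(FreeSymmCat.mult A).obj (x ++ y)] ++ z))))
        (.gen (.adj ((x ++ y) ++ z)))
  | adj_normal (a : A) : PsClassifierRel (.gen (.adj [a])) (.id [a])

/-- Generators and relations for `Q A`. -/
abbrev psClassifierPresentation : SymPresentation.{u} where
  Letter := A
  Gen := PsClassifierGen A
  Rel := PsClassifierRel A

/-- The pseudomorphism classifier `Q A` of a symmetric strict monoidal category `A`. -/
abbrev PsClassifier : Type u := (psClassifierPresentation A).Cat

end PsClassifier

namespace PsClassifier

section

variable {A : Type u} [Category.{u} A] [MonoidalCategory A] [SymmetricCategory A]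
  [StrictMonoidal A]

/-- The tuple with the given entries, as an object of `Q A`. -/
def tuple (x : List A) : PsClassifier A := x

theorem listProd_singleton {L : Type u} {C : Type u₁} [Category.{v₁} C] [MonoidalCategory C]
    [StrictMonoidal C] (o : L → C) (l : L) : listProd o [l] = o l :=
  StrictMonoidal.tensor_unit _

theorem mult_append_mult (x y z : List A) :
    listProd (fun a : A => a) (x ++ [listProd (fun a : A => a) y] ++ z) =
      listProd (fun a : A => a) (x ++ y ++ z) := by
  rw [listProd_append, listProd_append, listProd_append, listProd_append, listProd_singleton]

/-- All relations hold between parallel formal morphisms. -/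
theorem rel_ends {x y x' y' : List A} {f : SymTerm (PsClassifierGen A) x y}
    {g : SymTerm (PsClassifierGen A) x' y'} (h : PsClassifierRel A f g) : x = x' ∧ y = y' := by
  cases h with
  | adj_unit x y =>
    refine ⟨by simp, congrArg (fun a => [a]) ?_⟩
    have h := mult_append_mult x [] y
    simp only [List.append_nil, List.nil_append, List.append_assoc] at h ⊢
    exact h
  | adj_assoc_right x y z =>
    refine ⟨rfl, congrArg (fun a => [a]) ?_⟩
    have h := mult_append_mult x (y ++ z) []
    simp only [List.append_nil, List.nil_append, List.append_assoc] at h ⊢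
    exact h
  | adj_assoc_left x y z =>
    refine ⟨rfl, congrArg (fun a => [a]) ?_⟩
    have h := mult_append_mult [] (x ++ y) z
    simp only [List.append_nil, List.nil_append, List.append_assoc] at h ⊢
    exact h
  | adj_normal a => exact ⟨rfl, congrArg (fun a => [a]) (StrictMonoidal.tensor_unit a)⟩
  | _ => exact ⟨rfl, rfl⟩

end

section Mate

variable {A : Type u} [Category.{u} A] [MonoidalCategory A] [SymmetricCategory A]
  [StrictMonoidal A] {B : Type u₂} [Category.{v₂} B] [MonoidalCategory B] [SymmetricCategory B]
  [StrictMonoidal B] (F : A ⥤ B) [F.Braided]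

open Functor.LaxMonoidal Functor.Monoidal

/-- The isomorphism `F a₁ ⊗ ⋯ ⊗ F aₙ ≅ F (a₁ ⊗ ⋯ ⊗ aₙ)` obtained by iterating the monoidal
constraints of `F`. -/
def bullet : ∀ x : List A, listProd F.obj x ≅ F.obj (listProd (fun a : A => a) x)
  | [] => εIso F
  | a :: x => whiskerLeftIso (F.obj a) (bullet x) ≪≫ μIso F a (listProd (fun a : A => a) x)

theorem bullet_cons (a : A) (x : List A) :
    (bullet F (a :: x)).hom = (F.obj a ◁ (bullet F x).hom) ≫ μ F a _ := rfl

theorem heq_μ {a b a' b' : A} (h : a = a') (h' : b = b') : HEq (μ F a b) (μ F a' b') := by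
  subst h h'; rfl

theorem heq_bullet {x y : List A} (h : x = y) : HEq (bullet F x).hom (bullet F y).hom := by
  subst h; rfl

theorem μ_unit_left (a : A) : HEq ((ε F ▷ F.obj a) ≫ μ F (𝟙_ A) a) (𝟙 (F.obj a)) := by
  have h := left_unitality F a
  rw [StrictMonoidal.leftUnitor_hom, StrictMonoidal.leftUnitor_hom, eqToHom_map,
    ← Category.assoc] at h
  exact (comp_eqToHom_heq _ _).symm.trans ((heq_of_eq h.symm).trans
    ((StrictMonoidal.heq_eqToHom _ rfl).trans
      (StrictMonoidal.heq_id (StrictMonoidal.unit_tensor _))))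

theorem μ_unit_right (a : A) : HEq ((F.obj a ◁ ε F) ≫ μ F a (𝟙_ A)) (𝟙 (F.obj a)) := by
  have h := right_unitality F a
  rw [StrictMonoidal.rightUnitor_hom, StrictMonoidal.rightUnitor_hom, eqToHom_map,
    ← Category.assoc] at h
  exact (comp_eqToHom_heq _ _).symm.trans ((heq_of_eq h.symm).trans
    ((StrictMonoidal.heq_eqToHom _ rfl).trans
      (StrictMonoidal.heq_id (StrictMonoidal.tensor_unit _))))

theorem μ_assoc (a b c : A) :
    HEq ((μ F a b ▷ F.obj c) ≫ μ F (a ⊗ b) c) ((F.obj a ◁ μ F b c) ≫ μ F a (b ⊗ c)) := by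
  have h := associativity F a b c
  rw [StrictMonoidal.associator_hom, StrictMonoidal.associator_hom, eqToHom_map,
    ← Category.assoc] at h
  exact (comp_eqToHom_heq _ _).symm.trans ((heq_of_eq h).trans (eqToHom_comp_heq _ _))

theorem bullet_singleton (a : A) : HEq (bullet F [a]).hom (𝟙 (F.obj a)) :=
  μ_unit_right F a

theorem bullet_append (x y : List A) :
    HEq (bullet F (x ++ y)).hom (((bullet F x).hom ⊗ₘ (bullet F y).hom) ≫
      μ F (listProd (fun a : A => a) x) (listProd (fun a : A => a) y)) := by
  have M : ∀ x y : List A, listProd (fun a : A => a) (x ++ y) =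
      listProd (fun a : A => a) x ⊗ listProd (fun a : A => a) y := listProd_append _
  have P : ∀ x y : List A, listProd F.obj (x ++ y) = listProd F.obj x ⊗ listProd F.obj y :=
    listProd_append _
  induction x with
  | nil =>
    have h : ((bullet F []).hom ⊗ₘ (bullet F y).hom) ≫ μ F (listProd (fun a : A => a) [])
        (listProd (fun a : A => a) y) =
        (𝟙 (𝟙_ B) ⊗ₘ (bullet F y).hom) ≫ ((ε F ▷ F.obj _) ≫ μ F (𝟙_ A) _) := by
      rw [tensorHom_def', Category.assoc, id_tensorHom]
      rfl
    refine HEq.trans ?_ (heq_of_eq h.symm)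
    refine (heq_of_eq (Category.comp_id (bullet F y).hom).symm).trans
      (StrictMonoidal.heq_comp' (StrictMonoidal.unit_tensor _).symm
        (StrictMonoidal.unit_tensor _).symm
        (congrArg F.obj (StrictMonoidal.unit_tensor _)).symm
        (StrictMonoidal.unit_tensor_heq _).symm (μ_unit_left F _).symm)
  | cons a x ih =>
    have h : ((bullet F (a :: x)).hom ⊗ₘ (bullet F y).hom) ≫
        μ F (listProd (fun a : A => a) (a :: x)) (listProd (fun a : A => a) y) =
        ((𝟙 (F.obj a) ⊗ₘ (bullet F x).hom) ⊗ₘ (bullet F y).hom) ≫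
          ((μ F a (listProd (fun a : A => a) x) ▷ F.obj _) ≫
            μ F (a ⊗ listProd (fun a : A => a) x) (listProd (fun a : A => a) y)) := by
      rw [← Category.assoc, ← tensorHom_id, tensorHom_comp_tensorHom, Category.comp_id,
        id_tensorHom]
      rfl
    have h' : (𝟙 (F.obj a) ⊗ₘ (((bullet F x).hom ⊗ₘ (bullet F y).hom) ≫
        μ F (listProd (fun a : A => a) x) (listProd (fun a : A => a) y))) ≫ μ F a _ =
        (𝟙 (F.obj a) ⊗ₘ ((bullet F x).hom ⊗ₘ (bullet F y).hom)) ≫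
          ((F.obj a ◁ μ F _ _) ≫ μ F a _) := by
      rw [← Category.assoc, ← id_tensorHom, tensorHom_comp_tensorHom, Category.comp_id]
    have h'' : (bullet F (a :: x ++ y)).hom = (𝟙 (F.obj a) ⊗ₘ (bullet F (x ++ y)).hom) ≫
        μ F a (listProd (fun a : A => a) (x ++ y)) := by
      rw [id_tensorHom]; rfl
    refine (heq_of_eq h'').trans (HEq.trans ?_ (heq_of_eq h.symm))
    refine (StrictMonoidal.heq_comp' (congrArg (fun b : B => F.obj a ⊗ b) (P x y))
      (congrArg (fun c : A => F.obj a ⊗ F.obj c) (M x y))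
      (congrArg (fun c : A => F.obj (a ⊗ c)) (M x y))
      (StrictMonoidal.heq_tensor rfl rfl (P x y) (congrArg F.obj (M x y)) HEq.rfl ih)
      (heq_μ F rfl (M x y))).trans ((heq_of_eq h').trans ?_)
    exact StrictMonoidal.heq_comp' (StrictMonoidal.tensor_assoc _ _ _).symm
      (StrictMonoidal.tensor_assoc _ _ _).symm
      (congrArg F.obj (StrictMonoidal.tensor_assoc _ _ _)).symm
      (StrictMonoidal.tensor_assoc_heq _ _ _).symm (μ_assoc F _ _ _).symm

theorem natural_id {b : B} {a : A} (f : b ⟶ F.obj a) : 𝟙 b ≫ f = f ≫ F.map (𝟙 a) := by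
  simp

theorem natural_comp {b₁ b₂ b₃ : B} {a₁ a₂ a₃ : A} {s : b₁ ⟶ b₂} {t : b₂ ⟶ b₃}
    {f₁ : b₁ ⟶ F.obj a₁} {f₂ : b₂ ⟶ F.obj a₂} {f₃ : b₃ ⟶ F.obj a₃} {s' : a₁ ⟶ a₂}
    {t' : a₂ ⟶ a₃} (h : s ≫ f₂ = f₁ ≫ F.map s') (h' : t ≫ f₃ = f₂ ≫ F.map t') :
    (s ≫ t) ≫ f₃ = f₁ ≫ F.map (s' ≫ t') := by
  rw [Category.assoc, h', ← Category.assoc, h, F.map_comp, Category.assoc]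

theorem natural_tensor {b₁ b₂ c₁ c₂ : B} {a₁ a₂ d₁ d₂ : A} {s : b₁ ⟶ b₂} {t : c₁ ⟶ c₂}
    {f₁ : b₁ ⟶ F.obj a₁} {f₂ : b₂ ⟶ F.obj a₂} {g₁ : c₁ ⟶ F.obj d₁} {g₂ : c₂ ⟶ F.obj d₂}
    {s' : a₁ ⟶ a₂} {t' : d₁ ⟶ d₂} (h : s ≫ f₂ = f₁ ≫ F.map s')
    (h' : t ≫ g₂ = g₁ ≫ F.map t') :
    (s ⊗ₘ t) ≫ (f₂ ⊗ₘ g₂) ≫ μ F a₂ d₂ =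
      ((f₁ ⊗ₘ g₁) ≫ μ F a₁ d₁) ≫ F.map (s' ⊗ₘ t') := by
  rw [← Category.assoc, tensorHom_comp_tensorHom, h, h', ← tensorHom_comp_tensorHom,
    Category.assoc, Category.assoc, μ_natural]

theorem natural_braid {b c : B} {a d : A} (f : b ⟶ F.obj a) (g : c ⟶ F.obj d) :
    (β_ b c).hom ≫ (g ⊗ₘ f) ≫ μ F d a = ((f ⊗ₘ g) ≫ μ F a d) ≫ F.map (β_ a d).hom := by
  rw [← Category.assoc, ← BraidedCategory.braiding_naturality, Category.assoc, Category.assoc,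
    ← Functor.LaxBraided.braided]

theorem natural_adj {b₁ b₂ : B} {a₁ a₂ : A} {s : b₁ ⟶ b₂} {f₁ : b₁ ⟶ F.obj a₁}
    {f₂ : b₂ ⟶ F.obj a₂} {s' : a₁ ⟶ a₂} (h : s ≫ f₂ = f₁ ≫ F.map s') :
    s ≫ f₂ ≫ (ρ_ (F.obj a₂)).inv =
      (f₁ ≫ (ρ_ (F.obj a₁)).inv) ≫ (F.map s' ⊗ₘ 𝟙 (𝟙_ B)) := by
  rw [tensorHom_id, Category.assoc, ← rightUnitor_inv_naturality, ← Category.assoc, h,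
    Category.assoc]

/-- The iterated constraints of `F` are natural. -/
theorem bullet_natural {x y : FreeSymmCat A} (t : x ⟶ y) :
    (FreeSymmCat.lift F).map t ≫ (bullet F y).hom =
      (bullet F x).hom ≫ F.map ((FreeSymmCat.mult A).map t) := by
  have M : ∀ x y : List A, listProd (fun a : A => a) (x ++ y) =
      listProd (fun a : A => a) x ⊗ listProd (fun a : A => a) y := listProd_append _
  have P : ∀ x y : List A, listProd F.obj (x ++ y) = listProd F.obj x ⊗ listProd F.obj y :=
    listProd_append _
  obtain ⟨t, rfl⟩ := SymPresentation.homMk_surjective t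
  induction t with
  | gen s =>
    cases s with
    | @mor a b s =>
      change (F.map s ⊗ₘ 𝟙 (𝟙_ B)) ≫ (F.obj b ◁ ε F) ≫ μ F b (𝟙_ A) =
        ((F.obj a ◁ ε F) ≫ μ F a (𝟙_ A)) ≫ F.map (s ⊗ₘ 𝟙 (𝟙_ A))
      rw [tensorHom_id, tensorHom_id, Category.assoc, ← μ_natural_left,
        whisker_exchange_assoc]
  | id x => exact natural_id F (bullet F x).hom
  | comp s t ih₁ ih₂ => exact natural_comp F ih₁ ih₂
  | tensor s t ih₁ ih₂ =>
    let s' := SymPresentation.homMk (p := freeSymmCatPresentation A) s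
    let t' := SymPresentation.homMk (p := freeSymmCatPresentation A) t
    apply eq_of_heq
    refine (StrictMonoidal.heq_comp' (P _ _) (P _ _) (congrArg F.obj (M _ _))
      ((FreeSymmCat.lift_isStrictSymmetric F).map_tensor s' t') (bullet_append F _ _)).trans ?_
    refine HEq.trans ?_ (StrictMonoidal.heq_comp' (P _ _) (congrArg F.obj (M _ _))
      (congrArg F.obj (M _ _)) (bullet_append F _ _) (IsStrictSymmetric.map_heq F (M _ _) (M _ _)
        ((FreeSymmCat.lift_isStrictSymmetric (𝟭 A)).map_tensor s' t'))).symm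
    exact heq_of_eq (natural_tensor F ih₁ ih₂)
  | braid x y =>
    apply eq_of_heq
    refine (StrictMonoidal.heq_comp' (P _ _) (P _ _) (congrArg F.obj (M _ _))
      ((FreeSymmCat.lift_isStrictSymmetric F).map_braiding x y) (bullet_append F _ _)).trans ?_
    refine HEq.trans ?_ (StrictMonoidal.heq_comp' (P _ _) (congrArg F.obj (M _ _))
      (congrArg F.obj (M _ _)) (bullet_append F _ _) (IsStrictSymmetric.map_heq F (M _ _) (M _ _)
        ((FreeSymmCat.lift_isStrictSymmetric (𝟭 A)).map_braiding x y))).symm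
    exact heq_of_eq (natural_braid F _ _)

/-- The value on adjoined isomorphisms of the strict functor `Q A ⥤ B` determined by `F`. -/
def mateAdj (x : List A) :
    listProd F.obj x ≅ listProd F.obj [(FreeSymmCat.mult A).obj x] :=
  bullet F x ≪≫ (ρ_ (F.obj ((FreeSymmCat.mult A).obj x))).symm

theorem mateAdj_heq (x : List A) : HEq (mateAdj F x).hom (bullet F x).hom := by
  have h : (ρ_ (F.obj ((FreeSymmCat.mult A).obj x))).inv =
      eqToHom (StrictMonoidal.tensor_unit _).symm := by
    rw [← cancel_epi (ρ_ (F.obj ((FreeSymmCat.mult A).obj x))).hom, Iso.hom_inv_id,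
      StrictMonoidal.rightUnitor_hom, eqToHom_trans, eqToHom_refl]
  change HEq ((bullet F x).hom ≫ (ρ_ (F.obj ((FreeSymmCat.mult A).obj x))).inv) _
  rw [h]
  exact comp_eqToHom_heq _ _

/-- The value on generating morphisms of the strict functor `Q A ⥤ B` determined by `F`. -/
def mateGen : ∀ x y : List A, PsClassifierGen A x y → (listProd F.obj x ⟶ listProd F.obj y)
  | _, _, .free t => (FreeSymmCat.lift F).map t
  | _, _, .adj x => (mateAdj F x).hom
  | _, _, .adjInv x => (mateAdj F x).inv

theorem bullet_block (x y z : List A) :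
    HEq (((𝟙 (listProd F.obj x) ⊗ₘ (bullet F y).hom) ⊗ₘ 𝟙 (listProd F.obj z)) ≫
      (((bullet F x).hom ⊗ₘ 𝟙 _) ≫ μ F (listProd (fun a : A => a) x)
        (listProd (fun a : A => a) y) ⊗ₘ (bullet F z).hom) ≫ μ F _ _)
      (bullet F ((x ++ y) ++ z)).hom := by
  rw [← Category.assoc, tensorHom_comp_tensorHom, ← Category.assoc, tensorHom_comp_tensorHom,
    Category.id_comp, Category.id_comp, Category.comp_id]
  have M : ∀ x y : List A, listProd (fun a : A => a) (x ++ y) =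
      listProd (fun a : A => a) x ⊗ listProd (fun a : A => a) y := listProd_append _
  have P : ∀ x y : List A, listProd F.obj (x ++ y) = listProd F.obj x ⊗ listProd F.obj y :=
    listProd_append _
  refine ((bullet_append F (x ++ y) z).trans ?_).symm
  exact StrictMonoidal.heq_comp' (congrArg (fun b : B => b ⊗ _) (P _ _))
    (congrArg (fun a : A => F.obj a ⊗ _) (M _ _)) (congrArg (fun a : A => F.obj (a ⊗ _)) (M _ _))
    (StrictMonoidal.heq_tensor (P _ _) (congrArg F.obj (M _ _)) rfl rfl (bullet_append F x y)
      HEq.rfl) (heq_μ F (M _ _) rfl)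

/-- The iterated constraints of `F` can be formed blockwise. -/
theorem mate_block (x y z : List A) :
    HEq ((((SymTerm.id x).tensor (.gen (.adj y))).tensor (.id z)).comp
          (.gen (.adj ((x ++ [(FreeSymmCat.mult A).obj y]) ++ z))) |>.eval F.obj (mateGen F))
      (bullet F ((x ++ y) ++ z)).hom := by
  have M : ∀ x y : List A, listProd (fun a : A => a) (x ++ y) =
      listProd (fun a : A => a) x ⊗ listProd (fun a : A => a) y := listProd_append _
  have P : ∀ x y : List A, listProd F.obj (x ++ y) = listProd F.obj x ⊗ listProd F.obj y :=
    listProd_append _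
  have S : ∀ y : List A, listProd F.obj [(FreeSymmCat.mult A).obj y] =
      F.obj ((FreeSymmCat.mult A).obj y) := fun y => listProd_singleton F.obj _
  have S' : ∀ y : List A, listProd (fun a : A => a) [(FreeSymmCat.mult A).obj y] =
      listProd (fun a : A => a) y := fun y => listProd_singleton _ _
  refine HEq.trans ?_ (bullet_block F x y z)
  have P3 : listProd F.obj (x ++ [(FreeSymmCat.mult A).obj y] ++ z) =
      (listProd F.obj x ⊗ F.obj (listProd (fun a : A => a) y)) ⊗ listProd F.obj z := by
    rw [P, P, S]; rfl
  have M3 : listProd (fun a : A => a) (x ++ [(FreeSymmCat.mult A).obj y] ++ z) =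
      (listProd (fun a : A => a) x ⊗ listProd (fun a : A => a) y) ⊗
        listProd (fun a : A => a) z := by
    rw [M, M, S']
  refine StrictMonoidal.heq_comp' (by rw [P, P]) P3 ((S _).trans (congrArg F.obj M3)) ?_ ?_
  · refine (SymTerm.eval_tensor_heq _ _ _ _).trans ?_
    refine StrictMonoidal.heq_tensor (P _ _) ((P _ _).trans (congrArg _ (S y))) rfl rfl ?_ HEq.rfl
    refine (SymTerm.eval_tensor_heq _ _ _ _).trans ?_
    exact StrictMonoidal.heq_tensor rfl rfl rfl (S y) HEq.rfl (mateAdj_heq F y)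
  · refine (mateAdj_heq F _).trans ((bullet_append F _ _).trans ?_)
    refine StrictMonoidal.heq_comp' (congrArg (· ⊗ listProd F.obj z)
        ((P _ _).trans (congrArg _ (S y))))
      (congrArg (fun a : A => F.obj a ⊗ _) ((M _ _).trans (congrArg _ (S' y))))
      (congrArg (fun a : A => F.obj (a ⊗ _)) ((M _ _).trans (congrArg _ (S' y)))) ?_
      (heq_μ F ((M _ _).trans (congrArg _ (S' y))) rfl)
    refine StrictMonoidal.heq_tensor ((P _ _).trans (congrArg _ (S y)))
      (congrArg F.obj ((M _ _).trans (congrArg _ (S' y)))) rfl rfl ?_ HEq.rfl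
    refine (bullet_append F _ _).trans ?_
    exact StrictMonoidal.heq_comp' (congrArg _ (S y)) (congrArg (fun a : A => _ ⊗ F.obj a) (S' y))
      (congrArg (fun a : A => F.obj (_ ⊗ a)) (S' y))
      (StrictMonoidal.heq_tensor rfl rfl (S y) (congrArg F.obj (S' y)) HEq.rfl
        (bullet_singleton F _)) (heq_μ F rfl (S' y))

theorem adj_equiv (R : SymTermRel (PsClassifierGen A)) {x y : List A} (h : x = y) :
    SymTerm.Equiv R (.gen (.adj x)) (.gen (.adj y)) := by
  subst h; exact .refl _

theorem mate_rel ⦃x y x' y' : List A⦄ (f : SymTerm (PsClassifierGen A) x y)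
    (f' : SymTerm (PsClassifierGen A) x' y') (h : PsClassifierRel A f f') (_ : x = x')
    (_ : y = y') : HEq (f.eval F.obj (mateGen F)) (f'.eval F.obj (mateGen F)) := by
  have hs := FreeSymmCat.lift_isStrictSymmetric F
  cases h with
  | free_id x => exact heq_of_eq ((FreeSymmCat.lift F).map_id x)
  | free_comp s t => exact heq_of_eq ((FreeSymmCat.lift F).map_comp s t)
  | free_tensor s t =>
    exact (hs.map_tensor s t).trans
      (SymTerm.eval_tensor_heq F.obj (mateGen F) (.gen (.free s)) (.gen (.free t))).symm
  | free_braiding x y =>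
    exact (hs.map_braiding x y).trans (SymTerm.eval_braid_heq F.obj (mateGen F) _ _).symm
  | adj_adjInv x => exact heq_of_eq (mateAdj F x).hom_inv_id
  | adjInv_adj x => exact heq_of_eq (mateAdj F x).inv_hom_id
  | @adj_natural x y t =>
    exact heq_of_eq (natural_adj F (bullet_natural F t))
  | adj_unit x y =>
    refine (mate_block F x [] y).trans ((heq_bullet F ?_).trans (mateAdj_heq F _).symm)
    simp
  | adj_assoc_right x y z =>
    have h₁ := mate_block F x (y ++ z) []
    refine HEq.trans ?_ (h₁.trans ((heq_bullet F ?_).trans (mateAdj_heq F _).symm))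
    · exact SymTerm.eval_heq F.obj (mateGen F) (R := fun _ _ _ _ _ _ => False)
        (fun _ _ _ _ _ _ h => h.elim)
        (.comp_congr (.symm (.tensor_unit _)) (adj_equiv _ (List.append_nil _).symm))
    · simp
  | adj_assoc_left x y z =>
    have h₁ := mate_block F [] (x ++ y) z
    refine HEq.trans ?_ (h₁.trans (mateAdj_heq F _).symm)
    exact SymTerm.eval_heq F.obj (mateGen F) (R := fun _ _ _ _ _ _ => False)
      (fun _ _ _ _ _ _ h => h.elim)
      (.comp_congr (.tensor_congr (.symm (.unit_tensor _)) (.refl _)) (.refl _))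
  | adj_normal a =>
    exact ((mateAdj_heq F [a]).trans (bullet_singleton F a)).trans
      (StrictMonoidal.heq_id (listProd_singleton F.obj a).symm)

/-- The symmetric strict monoidal functor `Q A ⥤ B` that is the mate of a symmetric strong
monoidal functor `F : A ⥤ B`: it is the fold of `F` on tuples and on free morphisms, and it sends
the adjoined isomorphisms to the iterated monoidal constraints of `F`. -/
def mate : PsClassifier A ⥤ B :=
  SymPresentation.lift (p := psClassifierPresentation A) F.obj (mateGen F) (mate_rel F)

theorem mate_isStrictSymmetric : IsStrictSymmetric (mate F) :=
  SymPresentation.lift_isStrictSymmetric _ _ _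

end Mate

end PsClassifier

/-! ### The symmetric strict monoidal category `S(G', φ)` -/

/-- The letters of the words that are the objects of `S(G', φ)`: the elements of `G'`, and the
symbols `[φ]w` for tuples `w` in `G`, where `[φ](a)` is identified with `φ a` for the tuples `(a)`
of length one. -/
inductive UnivLetter (G G' : Type u) : Type u
  | free (c : G') : UnivLetter G G'
  | phi (w : List G) (h : w.length ≠ 1) : UnivLetter G G'

section Univ

variable {G G' : Type u} (φ : G → G')

/-- The letter `[φ]w`, which is `φ a` if `w = (a)`. -/
def phiLetter : List G → UnivLetter G G'
  | [] => .phi [] (by simp)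
  | [a] => .free (φ a)
  | a :: b :: w => .phi (a :: b :: w) (by simp)

variable (G) in
/-- The symmetric strict monoidal functor `S G ⥤ Q (S G)` sending a tuple `⟨aᵢ⟩ᵢ` to the tuple
`⟨(aᵢ)⟩ᵢ` of one-entry tuples. -/
def zetaFlat : FreeSymm G ⥤ PsClassifier (FreeSymm G) :=
  FreeSymm.lift fun a => PsClassifier.tuple [FreeSymm.tuple [a]]

/-- Generating morphisms of `S(G', φ)`: the morphisms of `S G'` and of `Q (S G)`. -/
inductive UnivGen : List (UnivLetter G G') → List (UnivLetter G G') → Type u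
  | free {x y : FreeSymm G'} (t : x ⟶ y) : UnivGen (List.map .free x) (List.map .free y)
  | phi {w v : PsClassifier (FreeSymm G)} (u : w ⟶ v) :
      UnivGen (List.map (phiLetter φ) w) (List.map (phiLetter φ) v)

/-- The inclusions of `S G'` and `Q (S G)` are symmetric strict monoidal functors, and they agree
on `S G`. -/
inductive UnivRel : SymTermRel (UnivGen φ)
  | free_id (x : FreeSymm G') : UnivRel (.gen (.free (𝟙 x))) (.id (List.map .free x))
  | free_comp {x y z : FreeSymm G'} (s : x ⟶ y) (t : y ⟶ z) :
      UnivRel (.gen (.free (s ≫ t))) ((SymTerm.gen (.free s)).comp (.gen (.free t)))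
  | free_tensor {x y x' y' : FreeSymm G'} (s : x ⟶ y) (t : x' ⟶ y') :
      UnivRel (.gen (.free (s ⊗ₘ t))) ((SymTerm.gen (.free s)).tensor (.gen (.free t)))
  | free_braiding (x y : FreeSymm G') :
      UnivRel (.gen (.free (β_ x y).hom)) (.braid (List.map .free x) (List.map .free y))
  | phi_id (w : PsClassifier (FreeSymm G)) :
      UnivRel (.gen (.phi (𝟙 w))) (.id (List.map (phiLetter φ) w))
  | phi_comp {w v z : PsClassifier (FreeSymm G)} (s : w ⟶ v) (t : v ⟶ z) :
      UnivRel (.gen (.phi (s ≫ t))) ((SymTerm.gen (.phi s)).comp (.gen (.phi t)))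
  | phi_tensor {w v w' v' : PsClassifier (FreeSymm G)} (s : w ⟶ v) (t : w' ⟶ v') :
      UnivRel (.gen (.phi (s ⊗ₘ t))) ((SymTerm.gen (.phi s)).tensor (.gen (.phi t)))
  | phi_braiding (w v : PsClassifier (FreeSymm G)) :
      UnivRel (.gen (.phi (β_ w v).hom))
        (.braid (List.map (phiLetter φ) w) (List.map (phiLetter φ) v))
  | pushout {x y : FreeSymm G} (t : x ⟶ y) :
      UnivRel (.gen (.free ((FreeSymm.map φ).map t))) (.gen (.phi ((zetaFlat G).map t)))

/-- Generators and relations for `S(G', φ)`. -/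
abbrev univPresentation : SymPresentation.{u} where
  Letter := UnivLetter G G'
  Gen := UnivGen φ
  Rel := UnivRel φ

/-- The symmetric strict monoidal category `S(G', φ)`: the pushout, among symmetric strict
monoidal categories and symmetric strict monoidal functors, of `S φ : S G ⥤ S G'` and
`ζ♭ : S G ⥤ Q (S G)`. -/
abbrev Univ : Type u := (univPresentation φ).Cat

namespace Univ

theorem map_free_map (x : List G) :
    List.map (UnivLetter.free (G := G)) ((FreeSymm.map φ).obj x) =
      List.map (phiLetter φ) ((zetaFlat G).obj x) := by
  induction x with
  | nil => rfl
  | cons a x ih => exact congrArg (UnivLetter.free (φ a) :: ·) ih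

/-- All relations hold between parallel formal morphisms. -/
theorem rel_ends {x y x' y' : List (UnivLetter G G')} {f : SymTerm (UnivGen φ) x y}
    {g : SymTerm (UnivGen φ) x' y'} (h : UnivRel φ f g) : x = x' ∧ y = y' := by
  cases h with
  | free_tensor s t => exact ⟨List.map_append, List.map_append⟩
  | free_braiding x y => exact ⟨List.map_append, List.map_append⟩
  | phi_tensor s t => exact ⟨List.map_append, List.map_append⟩
  | phi_braiding x y => exact ⟨List.map_append, List.map_append⟩
  | pushout t => exact ⟨map_free_map φ _, map_free_map φ _⟩
  | _ => exact ⟨rfl, rfl⟩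

theorem homMk_heq_of_rel {x y x' y' : List (UnivLetter G G')} {f : SymTerm (UnivGen φ) x y}
    {g : SymTerm (UnivGen φ) x' y'} (h : UnivRel φ f g) :
    HEq (SymPresentation.homMk (p := univPresentation φ) f)
      (SymPresentation.homMk (p := univPresentation φ) g) :=
  SymPresentation.homMk_heq (p := univPresentation φ)
    (.of (rel_ends φ h).1 (rel_ends φ h).2 h)

/-- The inclusion `κ : S G' ⥤ S(G', φ)` of free objects and free morphisms. -/
def kappa : FreeSymm G' ⥤ Univ φ where
  obj x := (List.map .free x : List (UnivLetter G G'))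
  map t := SymPresentation.homMk (p := univPresentation φ) (.gen (.free t))
  map_id x := eq_of_heq (homMk_heq_of_rel φ (.free_id x))
  map_comp s t := eq_of_heq (homMk_heq_of_rel φ (.free_comp s t))

/-- The functor `φ̂ : Q (S G) ⥤ S(G', φ)`, whose image consists of the `φ`-objects
`⟨[φ]wⱼ⟩ⱼ` and the `φ`-morphisms. -/
def phiHat : PsClassifier (FreeSymm G) ⥤ Univ φ where
  obj w := (List.map (phiLetter φ) w : List (UnivLetter G G'))
  map u := SymPresentation.homMk (p := univPresentation φ) (.gen (.phi u))
  map_id w := eq_of_heq (homMk_heq_of_rel φ (.phi_id w))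
  map_comp s t := eq_of_heq (homMk_heq_of_rel φ (.phi_comp s t))

theorem kappa_isStrictSymmetric : IsStrictSymmetric (kappa φ) where
  obj_unit := rfl
  obj_tensor x y := List.map_append (l₁ := (x : List G')) (l₂ := (y : List G'))
  map_tensor s t := homMk_heq_of_rel φ (.free_tensor s t)
  map_braiding x y := homMk_heq_of_rel φ (.free_braiding x y)

theorem phiHat_isStrictSymmetric : IsStrictSymmetric (phiHat φ) where
  obj_unit := rfl
  obj_tensor x y := List.map_append (l₁ := (x : List (List G))) (l₂ := (y : List (List G)))
  map_tensor s t := homMk_heq_of_rel φ (.phi_tensor s t)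
  map_braiding x y := homMk_heq_of_rel φ (.phi_braiding x y)

end Univ

end Univ

/-! ### The functor `Λ` -/

namespace Univ

section Lam

variable {X : Type u} [Category.{u} X] [MonoidalCategory X] [SymmetricCategory X]
  [StrictMonoidal X] {Y : Type u} [Category.{u} Y] [MonoidalCategory Y] [SymmetricCategory Y]
  [StrictMonoidal Y] (F : X ⥤ Y) [F.Braided]

/-- The symmetric strong monoidal functor `S (ob X) ⥤ X ⥤ Y`. -/
@[reducible]
def multComp : FreeSymm X ⥤ Y := FreeSymm.mult X ⋙ F

instance multComp_braided : (multComp F).Braided :=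
  letI : (FreeSymm.mult X).Braided :=
    IsStrictSymmetric.braided (FreeSymm.lift_isStrictSymmetric _)
  inferInstanceAs (FreeSymm.mult X ⋙ F).Braided

/-- The values of `Λ` on letters. -/
def lamLetter : UnivLetter X Y → Y
  | .free c => c
  | .phi w _ => F.obj ((FreeSymm.mult X).obj (FreeSymm.tuple w))

theorem lamLetter_phiLetter (w : List X) :
    lamLetter F (phiLetter F.obj w) = F.obj ((FreeSymm.mult X).obj (FreeSymm.tuple w)) :=
  match w with
  | [] => rfl
  | [a] => congrArg F.obj (StrictMonoidal.tensor_unit a).symm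
  | _ :: _ :: _ => rfl

theorem lam_free (x : FreeSymm Y) :
    listProd (lamLetter F) (List.map .free x) = (FreeSymm.mult Y).obj x := by
  change listProd (lamLetter F) (List.map .free x) = listProd (fun c : Y => c) x
  induction (x : List Y) with
  | nil => rfl
  | cons c x ih => exact congrArg (fun d : Y => c ⊗ d) ih

theorem lam_phi (w : PsClassifier (FreeSymm X)) :
    listProd (lamLetter F) (List.map (phiLetter F.obj) w) =
      (PsClassifier.mate (multComp F)).obj w := by
  change listProd (lamLetter F) (List.map (phiLetter F.obj) w) = listProd (multComp F).obj w
  induction (w : List (List X)) with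
  | nil => rfl
  | cons v w ih =>
    exact congrArg₂ (fun c d : Y => c ⊗ d) (lamLetter_phiLetter F v) ih

/-- The values of `Λ` on generating morphisms: the product of `Y` on free morphisms, and the mate
of `S (ob X) ⥤ X ⥤ Y` on `φ`-morphisms. -/
def lamGen : ∀ x y : List (UnivLetter X Y), UnivGen F.obj x y →
    (listProd (lamLetter F) x ⟶ listProd (lamLetter F) y)
  | _, _, .free t =>
      eqToHom (lam_free F _) ≫ (FreeSymm.mult Y).map t ≫ eqToHom (lam_free F _).symm
  | _, _, .phi u =>
      eqToHom (lam_phi F _) ≫ (PsClassifier.mate (multComp F)).map u ≫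
        eqToHom (lam_phi F _).symm

theorem lamGen_free {x y : FreeSymm Y} (t : x ⟶ y) :
    HEq (lamGen F _ _ (.free t)) ((FreeSymm.mult Y).map t) :=
  StrictMonoidal.conj_heq _ _ _

theorem lamGen_phi {w v : PsClassifier (FreeSymm X)} (u : w ⟶ v) :
    HEq (lamGen F _ _ (.phi u)) ((PsClassifier.mate (multComp F)).map u) :=
  StrictMonoidal.conj_heq _ _ _

theorem lam_rel ⦃x y x' y' : List (UnivLetter X Y)⦄ (f : SymTerm (UnivGen F.obj) x y)
    (f' : SymTerm (UnivGen F.obj) x' y') (h : UnivRel F.obj f f') (_ : x = x') (_ : y = y') :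
    HEq (f.eval (lamLetter F) (lamGen F)) (f'.eval (lamLetter F) (lamGen F)) := by
  have hs : IsStrictSymmetric (FreeSymm.mult Y) := FreeSymm.lift_isStrictSymmetric _
  have hm : IsStrictSymmetric (PsClassifier.mate (multComp F)) :=
    PsClassifier.mate_isStrictSymmetric _
  have L := lam_free F
  have M := lam_phi F
  cases h with
  | free_id x =>
    exact (lamGen_free F _).trans ((heq_of_eq ((FreeSymm.mult Y).map_id x)).trans
      (StrictMonoidal.heq_id (L x).symm))
  | free_comp s t =>
    exact (lamGen_free F _).trans ((heq_of_eq ((FreeSymm.mult Y).map_comp s t)).trans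
      (StrictMonoidal.heq_comp' (L _) (L _) (L _) (lamGen_free F s) (lamGen_free F t)).symm)
  | free_tensor s t =>
    exact (lamGen_free F _).trans ((hs.map_tensor s t).trans
      ((SymTerm.eval_tensor_heq (lamLetter F) (lamGen F) (.gen (.free s)) (.gen (.free t))).trans
        (StrictMonoidal.heq_tensor (L _) (L _) (L _) (L _) (lamGen_free F s)
          (lamGen_free F t))).symm)
  | free_braiding x y =>
    exact (lamGen_free F _).trans ((hs.map_braiding x y).trans
      ((SymTerm.eval_braid_heq (lamLetter F) (lamGen F) _ _).trans
        (StrictMonoidal.heq_braiding (L _) (L _))).symm)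
  | phi_id x =>
    exact (lamGen_phi F _).trans ((heq_of_eq ((PsClassifier.mate (multComp F)).map_id x)).trans
      (StrictMonoidal.heq_id (M x).symm))
  | phi_comp s t =>
    exact (lamGen_phi F _).trans
      ((heq_of_eq ((PsClassifier.mate (multComp F)).map_comp s t)).trans
      (StrictMonoidal.heq_comp' (M _) (M _) (M _) (lamGen_phi F s) (lamGen_phi F t)).symm)
  | phi_tensor s t =>
    exact (lamGen_phi F _).trans ((hm.map_tensor s t).trans
      ((SymTerm.eval_tensor_heq (lamLetter F) (lamGen F) (.gen (.phi s)) (.gen (.phi t))).trans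
        (StrictMonoidal.heq_tensor (M _) (M _) (M _) (M _) (lamGen_phi F s)
          (lamGen_phi F t))).symm)
  | phi_braiding x y =>
    exact (lamGen_phi F _).trans ((hm.map_braiding x y).trans
      ((SymTerm.eval_braid_heq (lamLetter F) (lamGen F) _ _).trans
        (StrictMonoidal.heq_braiding (M _) (M _))).symm)
  | pushout t =>
    refine (lamGen_free F _).trans (HEq.trans ?_ (lamGen_phi F _).symm)
    refine SymPresentation.map_heq_of_letters (p := freeSymmPresentation X)
      (F := FreeSymm.map F.obj ⋙ FreeSymm.mult Y)
      (G := zetaFlat X ⋙ PsClassifier.mate (multComp F))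
      ((FreeSymm.lift_isStrictSymmetric _).comp (FreeSymm.lift_isStrictSymmetric _))
      ((FreeSymm.lift_isStrictSymmetric _).comp (PsClassifier.mate_isStrictSymmetric _))
      (fun a => ?_) (fun _ _ s => PEmpty.elim s) t
    change F.obj a ⊗ 𝟙_ Y = F.obj (a ⊗ 𝟙_ X) ⊗ 𝟙_ Y
    rw [StrictMonoidal.tensor_unit a]

/-- The symmetric strict monoidal functor `Λ : S(ob Y, F_ob) ⥤ Y` determined by a symmetric strong
monoidal functor `F : X ⥤ Y`: its restriction along `κ` is the multiplication `S (ob Y) ⥤ Y`, and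
its restriction along `φ̂` is the composite `Q (S (ob X)) ⥤ Q X ⥤ Y` of the functor induced by the
multiplication of `X` with the mate of `F`. -/
def lam : Univ F.obj ⥤ Y :=
  SymPresentation.lift (p := univPresentation F.obj) (lamLetter F) (lamGen F) (lam_rel F)

theorem lam_isStrictSymmetric : IsStrictSymmetric (lam F) :=
  SymPresentation.lift_isStrictSymmetric _ _ _

theorem kappa_lam : kappa F.obj ⋙ lam F = FreeSymm.mult Y :=
  CategoryTheory.Functor.ext (lam_free F) fun _ _ _ => rfl

theorem phiHat_lam : phiHat F.obj ⋙ lam F = PsClassifier.mate (multComp F) :=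
  CategoryTheory.Functor.ext (lam_phi F) fun _ _ _ => rfl

end Lam

end Univ

/-! ### Doubling, quadrupling and the cyclic braiding -/

section Doubling

open Functor.LaxMonoidal

theorem tensorμ_braiding {A : Type u} [Category.{v} A] [MonoidalCategory A]
    [SymmetricCategory A] (X Y : A) :
    tensorμ X X Y Y ≫ ((β_ X Y).hom ⊗ₘ (β_ X Y).hom) =
      (β_ (X ⊗ X) (Y ⊗ Y)).hom ≫ tensorμ Y Y X X := by
  have h : (β_ (X ⊗ X) (Y ⊗ Y)).hom =
      tensorμ X X Y Y ≫ ((β_ X Y).hom ⊗ₘ (β_ X Y).hom) ≫ tensorδ Y Y X X := by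
    rw [BraidedCategory.braiding_tensor_left_hom]
    simp only [BraidedCategory.braiding_tensor_right_hom, tensorμ, tensorδ]
    rw [← SymmetricCategory.braiding_swap_eq_inv_braiding Y X]
    simp only [MonoidalCategory.tensorHom_def']
    monoidal
  rw [h, Category.assoc, Category.assoc, tensorδ_tensorμ, Category.comp_id]

variable (A : Type u) [Category.{v} A] [MonoidalCategory A] [SymmetricCategory A]

/-- The doubling functor `X ↦ X ⊗ X`, `s ↦ s ⊗ s`. -/
def doubling : A ⥤ A := Functor.diag A ⋙ tensor A

/-- The unit constraint of doubling is the canonical isomorphism `𝟙_ A ≅ 𝟙_ A ⊗ 𝟙_ A`, and its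
monoidal constraint exchanges the two middle factors. -/
instance doubling_monoidal : (doubling A).Monoidal :=
  inferInstanceAs (Functor.diag A ⋙ tensor A).Monoidal

variable {A} in
theorem doubling_μ (X Y : A) : μ (doubling A) X Y = tensorμ X X Y Y := by
  have h : μ (Functor.diag A ⋙ tensor A) X Y = tensorμ X X Y Y := by
    rw [Functor.LaxMonoidal.comp_μ]
    simp
  exact h

theorem doubling_ε : ε (doubling A) = (λ_ (𝟙_ A)).inv := by
  have h : ε (Functor.diag A ⋙ tensor A) = (λ_ (𝟙_ A)).inv := by
    rw [Functor.LaxMonoidal.comp_ε]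
    simp
  exact h

instance doubling_braided : (doubling A).Braided where
  braided X Y := by
    rw [doubling_μ, doubling_μ]
    exact tensorμ_braiding X Y

/-- The quadrupling functor, with its constraints as the composite of doubling with itself. -/
def quadrupling : A ⥤ A := doubling A ⋙ doubling A

instance quadrupling_braided : (quadrupling A).Braided :=
  inferInstanceAs (doubling A ⋙ doubling A).Braided

theorem quadrupling_μ (X Y : A) :
    μ (quadrupling A) X Y =
      μ (doubling A) ((doubling A).obj X) ((doubling A).obj Y) ≫
        (doubling A).map (μ (doubling A) X Y) := rfl

variable {A} in
theorem cyclic_naturality {X Y : A} (s : X ⟶ Y) :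
    ((s ⊗ₘ s) ⊗ₘ (s ⊗ₘ s)) ≫ (α_ Y Y (Y ⊗ Y)).hom ≫ (β_ Y (Y ⊗ (Y ⊗ Y))).hom ≫
      (α_ Y (Y ⊗ Y) Y).hom ≫ (Y ◁ (α_ Y Y Y).hom) ≫ (α_ Y Y (Y ⊗ Y)).inv =
    ((α_ X X (X ⊗ X)).hom ≫ (β_ X (X ⊗ (X ⊗ X))).hom ≫ (α_ X (X ⊗ X) X).hom ≫
      (X ◁ (α_ X X X).hom) ≫ (α_ X X (X ⊗ X)).inv) ≫ ((s ⊗ₘ s) ⊗ₘ (s ⊗ₘ s)) := by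
  rw [associator_naturality_assoc, BraidedCategory.braiding_naturality_assoc,
    associator_naturality_assoc]
  simp only [Category.assoc]
  congr 3
  rw [← associator_inv_naturality, ← id_tensorHom, ← id_tensorHom,
    tensorHom_comp_tensorHom_assoc, associator_naturality,
    tensorHom_comp_tensorHom_assoc, Category.comp_id, Category.id_comp]

/-- The cyclic braiding of the first of four equal factors past the other three, as a natural
transformation. -/
def cyclicBraiding : quadrupling A ⟶ quadrupling A where
  app X :=
    (α_ X X (X ⊗ X)).hom ≫ (β_ X (X ⊗ (X ⊗ X))).hom ≫ (α_ X (X ⊗ X) X).hom ≫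
      (X ◁ (α_ X X X).hom) ≫ (α_ X X (X ⊗ X)).inv
  naturality _ _ s := cyclic_naturality s

end Doubling

/-! ### The monoidal naturality diagram -/

/-- The vertices of the monoidal naturality diagram. -/
inductive NatVertex : Type
  | topLeft | midLeft | botLeft | topRight | midRight | botRight

/-- The edges of the monoidal naturality diagram. -/
inductive NatEdge : NatVertex → NatVertex → Type
  | top : NatEdge .topLeft .topRight
  | left₁ : NatEdge .topLeft .midLeft
  | left₂ : NatEdge .midLeft .botLeft
  | right₁ : NatEdge .topRight .midRight
  | right₂ : NatEdge .midRight .botRight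
  | bot : NatEdge .botLeft .botRight

instance : Quiver NatVertex := ⟨NatEdge⟩

section NatDiagram

open Functor.LaxMonoidal

variable {A : Type u} [Category.{v} A] [MonoidalCategory A] [SymmetricCategory A] (a b : A)

/-- The objects of the monoidal naturality diagram of the cyclic braiding at `a` and `b`. -/
def natDiagramObj : NatVertex → A
  | .topLeft => (quadrupling A).obj a ⊗ (quadrupling A).obj b
  | .midLeft => (doubling A).obj ((doubling A).obj a ⊗ (doubling A).obj b)
  | .botLeft => (quadrupling A).obj (a ⊗ b)
  | .topRight => (quadrupling A).obj a ⊗ (quadrupling A).obj b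
  | .midRight => (doubling A).obj ((doubling A).obj a ⊗ (doubling A).obj b)
  | .botRight => (quadrupling A).obj (a ⊗ b)

/-- The morphisms of the monoidal naturality diagram of the cyclic braiding at `a` and `b`. The
vertical composites are the monoidal constraints of quadrupling. -/
def natDiagramMap : ∀ {x y : NatVertex}, NatEdge x y → (natDiagramObj a b x ⟶ natDiagramObj a b y)
  | _, _, .top => (cyclicBraiding A).app a ⊗ₘ (cyclicBraiding A).app b
  | _, _, .left₁ => μ (doubling A) ((doubling A).obj a) ((doubling A).obj b)
  | _, _, .left₂ => (doubling A).map (μ (doubling A) a b)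
  | _, _, .right₁ => μ (doubling A) ((doubling A).obj a) ((doubling A).obj b)
  | _, _, .right₂ => (doubling A).map (μ (doubling A) a b)
  | _, _, .bot => (cyclicBraiding A).app (a ⊗ b)

/-- The monoidal naturality diagram of the cyclic braiding at `a` and `b`, as a functor on the free
category on its vertices and edges. -/
def natDiagram : Paths NatVertex ⥤ A :=
  Paths.lift { obj := natDiagramObj a b, map := fun e => natDiagramMap a b e }

/-- The left-bottom composite of the diagram. -/
def natLeftBottom : natDiagramObj a b .topLeft ⟶ natDiagramObj a b .botRight :=
  natDiagramMap a b .left₁ ≫ natDiagramMap a b .left₂ ≫ natDiagramMap a b .bot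

/-- The top-right composite of the diagram. -/
def natTopRight : natDiagramObj a b .topLeft ⟶ natDiagramObj a b .botRight :=
  natDiagramMap a b .top ≫ natDiagramMap a b .right₁ ≫ natDiagramMap a b .right₂

end NatDiagram

/-! ### Tidy composites -/

section Tidy

variable {A : Type u} [Category.{u} A] [MonoidalCategory A] (φ : A → A)

/-- The one-entry `φ`-object `([φ](0, …, 0))`, with `n` copies of the unit `0 = 𝟙_ A`. -/
def phiZeros (n : ℕ) : Univ φ :=
  (Univ.phiHat φ).obj (PsClassifier.tuple [FreeSymm.tuple (List.replicate n (𝟙_ A))])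

variable {φ}

/-- An object of `S(ob A, φ)` is tidy if it has no factors of the form `([φ](0, …, 0))`. -/
def IsTidy (x : Univ φ) : Prop :=
  ∀ (n : ℕ) (y z : Univ φ), x ≠ y ⊗ (phiZeros φ n ⊗ z)

/-- Formal morphisms: the isomorphisms formed from the symmetries of the product of
`S(ob A, φ)`. -/
inductive IsFormal : ∀ {x y : Univ φ}, (x ⟶ y) → Prop
  | id (x : Univ φ) : IsFormal (𝟙 x)
  | braiding (x y : Univ φ) : IsFormal (β_ x y).hom
  | comp {x y z : Univ φ} {s : x ⟶ y} {t : y ⟶ z} (hs : IsFormal s) (ht : IsFormal t) :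
      IsFormal (s ≫ t)
  | tensor {x y x' y' : Univ φ} {s : x ⟶ y} {t : x' ⟶ y'} (hs : IsFormal s) (ht : IsFormal t) :
      IsFormal (s ⊗ₘ t)

/-- Generating morphisms: the free morphisms, the `φ`-morphisms and the formal morphisms. -/
inductive IsGenerating : ∀ {x y : Univ φ}, (x ⟶ y) → Prop
  | free {x y : FreeSymm A} (t : x ⟶ y) : IsGenerating ((Univ.kappa φ).map t)
  | phi {w v : PsClassifier (FreeSymm A)} (u : w ⟶ v) : IsGenerating ((Univ.phiHat φ).map u)
  | formal {x y : Univ φ} {s : x ⟶ y} (hs : IsFormal s) : IsGenerating s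

/-- Products of generating morphisms. -/
inductive IsProductOfGenerating : ∀ {x y : Univ φ}, (x ⟶ y) → Prop
  | gen {x y : Univ φ} {s : x ⟶ y} (hs : IsGenerating s) : IsProductOfGenerating s
  | tensor {x y x' y' : Univ φ} {s : x ⟶ y} {t : x' ⟶ y'} (hs : IsProductOfGenerating s)
      (ht : IsProductOfGenerating t) : IsProductOfGenerating (s ⊗ₘ t)

/-- A composite of `r ≥ 1` morphisms is tidy if all its objects are tidy and all its morphisms are
products of generating morphisms. -/
structure IsTidyComposite {r : ℕ} (F : ComposableArrows (Univ φ) r) : Prop where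
  pos : 1 ≤ r
  obj : ∀ i : Fin (r + 1), IsTidy (F.obj i)
  map : ∀ (i : ℕ) (hi : i < r), IsProductOfGenerating (F.map' i (i + 1))

/-- The morphism `s` is the composite of a tidy sequence of morphisms. -/
def HasTidyFactorization {x y : Univ φ} (s : x ⟶ y) : Prop :=
  ∃ (r : ℕ) (F : ComposableArrows (Univ φ) r), IsTidyComposite F ∧ Arrow.mk F.hom = Arrow.mk s

end Tidy

/-! ### The free symmetric strict monoidal category on two objects -/

/-- The set of two generating objects. -/
inductive TwoLetters : Type
  | a | b

/-- The free symmetric strict monoidal category on two objects. -/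
abbrev FreeTwo : Type := FreeSymm TwoLetters

namespace FreeTwo

/-- The first generating object. -/
def a : FreeTwo := FreeSymm.tuple [TwoLetters.a]

/-- The second generating object. -/
def b : FreeTwo := FreeSymm.tuple [TwoLetters.b]

end FreeTwo

/-! The obstruction to using genuine `φ`-letters is a sign. Each generator `c` of `S{a,b}` gives a
symmetric strict monoidal functor `letterSign c` to `SignCat`, which counts the occurrences of `c`
and records the sign of their permutation.

Quadrupling is invisible to these signs: its values have counts divisible by 4, it sends a morphism
to a tensor square of a tensor square, and its constraints exchange even blocks or are doubled
morphisms (`hasTrivialSigns_quadrupling`). Hence `Λ` of every `φ`-morphism has sign 1. A free or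
formal morphism only permutes letters, so it also has sign 1 when every single letter of its source
contains `c` an even number of times. This letterwise parity is preserved in both directions by
products of generating morphisms, so a whole tidy composite starting at such an object has sign 1
(`IsTidyComposite.val_map_zero`). Evenness of the total count would not do: the symmetry of two odd
letters has sign -1.

The cyclic braiding at `x` has sign `(-1)^n`, with `n` the count of `c` in `x`, and `a + b` contains
each generator once. Both composites of the diagram, and its horizontal edges, therefore have sign
-1 for both choices of `c`. So a tidy lift must start, and stay, at objects having for each `c` a
letter with an odd count of `c`, while the total count of each `c` is 4 (`IsBalanced`).

A letter `[φ]w` that is not free has, by tidiness, a nonzero sum, so it contains some `c` a positive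
multiple of 4 times. It uses up all four occurrences, every letter is then even in `c`, and this is
a contradiction. Hence all objects of the lift are free (`IsTidy.isFree`).

It remains to lift the morphisms. Between free objects, a `φ`-morphism comes from a morphism of `Q
S(ob A)` between tuples of one-entry tuples. Conjugation by the isomorphisms `q` shows that `ζ♭` is
full (`zetaFlat_full`), so the pushout relation turns this morphism into a free one; free and formal
morphisms lift directly (`IsProductOfGenerating.liftsToKappa`). -/

/-- Induction on morphisms of a presented category. -/
theorem SymPresentation.hom_induction {p : SymPresentation.{u}}
    {P : ∀ {x y : p.Cat}, (x ⟶ y) → Prop}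
    (gen : ∀ {x y : List p.Letter} (s : p.Gen x y),
      P (SymPresentation.homMk (p := p) (.gen s)))
    (id : ∀ x : p.Cat, P (𝟙 x))
    (comp : ∀ {x y z : p.Cat} (s : x ⟶ y) (t : y ⟶ z), P s → P t → P (s ≫ t))
    (tensor : ∀ {x y x' y' : p.Cat} (s : x ⟶ y) (t : x' ⟶ y'), P s → P t → P (s ⊗ₘ t))
    (braid : ∀ x y : p.Cat, P (β_ x y).hom) {x y : p.Cat} (f : x ⟶ y) : P f := by
  obtain ⟨t, rfl⟩ := SymPresentation.homMk_surjective f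
  induction t with
  | gen s => exact gen s
  | id x => exact id x
  | comp s t ih₁ ih₂ => exact comp _ _ ih₁ ih₂
  | tensor s t ih₁ ih₂ => exact tensor _ _ ih₁ ih₂
  | braid x y => exact braid x y

/-! ### The category of signs -/

/-- The category whose objects are natural numbers and whose morphisms are signs on them. -/
def SignCat : Type := ℕ

namespace SignCat

/-- A sign, as an endomorphism of a natural number. -/
@[ext]
structure Hom (x y : SignCat) : Type where
  eq : x = y
  val : ℤˣ

instance : Category.{0} SignCat where
  Hom := Hom
  id _ := ⟨rfl, 1⟩
  comp s t := ⟨s.eq.trans t.eq, s.val * t.val⟩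
  id_comp _ := Hom.ext (one_mul _)
  comp_id _ := Hom.ext (mul_one _)
  assoc _ _ _ := Hom.ext (mul_assoc _ _ _)

/-- The sign underlying a morphism. -/
def val {x y : SignCat} (s : x ⟶ y) : ℤˣ := Hom.val s

theorem eq_of_hom {x y : SignCat} (s : x ⟶ y) : x = y := Hom.eq s

/-- Parallel morphisms are determined by their signs, so every coherence law below becomes an
identity in `ℤˣ`. -/
theorem val_ext {x y : SignCat} {s t : x ⟶ y} (h : val s = val t) : s = t := Hom.ext h

theorem val_id (x : SignCat) : val (𝟙 x) = 1 := rfl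

theorem val_comp {x y z : SignCat} (s : x ⟶ y) (t : y ⟶ z) : val (s ≫ t) = val s * val t := rfl

theorem val_eqToHom {x y : SignCat} (h : x = y) : val (eqToHom h) = 1 := by
  subst h; rfl

/-- Strict functors preserve products only up to equality of objects, so their laws are
heterogeneous equalities; a sign does not see this difference. -/
theorem val_heq {x y x' y' : SignCat} {s : x ⟶ y} {t : x' ⟶ y'} (hx : x = x') (hy : y = y')
    (h : HEq s t) : val s = val t := by
  subst hx hy; rw [eq_of_heq h]

/-- The number underlying an object. -/
def toNat (x : SignCat) : ℕ := x

instance : MonoidalCategoryStruct SignCat where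
  tensorObj x y := Nat.add x y
  tensorUnit := Nat.zero
  tensorHom s t := ⟨congrArg₂ Nat.add s.eq t.eq, s.val * t.val⟩
  whiskerLeft x _ _ s := ⟨congrArg (Nat.add x) s.eq, s.val⟩
  whiskerRight s x := ⟨congrArg (fun y => Nat.add y x) s.eq, s.val⟩
  associator x y z := eqToIso (Nat.add_assoc x y z)
  leftUnitor x := eqToIso (Nat.zero_add x)
  rightUnitor x := eqToIso (Nat.add_zero x)

theorem toNat_tensor (x y : SignCat) : toNat (x ⊗ y) = toNat x + toNat y := rfl

theorem val_tensor {x y x' y' : SignCat} (s : x ⟶ y) (t : x' ⟶ y') :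
    val (s ⊗ₘ t) = val s * val t := rfl

theorem val_whiskerLeft (x : SignCat) {y z : SignCat} (s : y ⟶ z) : val (x ◁ s) = val s := rfl

theorem val_whiskerRight {y z : SignCat} (s : y ⟶ z) (x : SignCat) : val (s ▷ x) = val s := rfl

theorem val_associator_hom (x y z : SignCat) : val (α_ x y z).hom = 1 :=
  val_eqToHom (Nat.add_assoc x y z)

theorem val_associator_inv (x y z : SignCat) : val (α_ x y z).inv = 1 :=
  val_eqToHom (Nat.add_assoc x y z).symm

theorem val_leftUnitor_hom (x : SignCat) : val (λ_ x).hom = 1 :=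
  val_eqToHom (Nat.zero_add x)

theorem val_rightUnitor_hom (x : SignCat) : val (ρ_ x).hom = 1 :=
  val_eqToHom (Nat.add_zero x)

instance : MonoidalCategory SignCat :=
  MonoidalCategory.ofTensorHom
    (id_tensorHom_id := fun _ _ => rfl)
    (id_tensorHom := fun _ _ _ _ => val_ext (one_mul _))
    (tensorHom_id := fun _ _ => val_ext (mul_one _))
    (tensorHom_comp_tensorHom := fun _ _ _ _ => val_ext (mul_mul_mul_comm _ _ _ _))
    (associator_naturality := fun _ _ _ => by
      apply val_ext
      simp only [val_comp, val_tensor, val_associator_hom, mul_one, one_mul, mul_assoc])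
    (leftUnitor_naturality := fun _ => by
      apply val_ext
      simp only [val_comp, val_tensor, val_leftUnitor_hom, val_id, mul_one, one_mul])
    (rightUnitor_naturality := fun _ => by
      apply val_ext
      simp only [val_comp, val_tensor, val_rightUnitor_hom, val_id, mul_one, one_mul])
    (pentagon := fun _ _ _ _ => by
      apply val_ext
      simp only [val_comp, val_tensor, val_associator_hom, val_id, mul_one])
    (triangle := fun _ _ => by
      apply val_ext
      simp only [val_comp, val_tensor, val_associator_hom, val_leftUnitor_hom,
        val_rightUnitor_hom, val_id, mul_one])

instance : StrictMonoidal SignCat where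
  tensor_assoc := Nat.add_assoc
  unit_tensor := Nat.zero_add
  tensor_unit := Nat.add_zero
  associator_hom _ _ _ := rfl
  leftUnitor_hom _ := rfl
  rightUnitor_hom _ := rfl

/-- The symmetry of the category of signs follows the Koszul rule. -/
def koszul (x y : SignCat) : x ⊗ y ≅ y ⊗ x where
  hom := ⟨Nat.add_comm x y, (-1) ^ (toNat x * toNat y)⟩
  inv := ⟨Nat.add_comm y x, (-1) ^ (toNat x * toNat y)⟩
  hom_inv_id := val_ext (Int.units_mul_self _)
  inv_hom_id := val_ext (Int.units_mul_self _)

theorem val_koszul_hom (x y : SignCat) :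
    val (koszul x y).hom = (-1) ^ (toNat x * toNat y) := rfl

instance : SymmetricCategory SignCat where
  braiding := koszul
  braiding_naturality_right _ _ _ s := by
    -- All morphisms are endomorphisms, so the two Koszul signs in the square coincide.
    obtain rfl := eq_of_hom s
    apply val_ext
    simp only [val_comp, val_whiskerLeft, val_whiskerRight, val_koszul_hom, mul_comm]
  braiding_naturality_left s _ := by
    obtain rfl := eq_of_hom s
    apply val_ext
    simp only [val_comp, val_whiskerLeft, val_whiskerRight, val_koszul_hom, mul_comm]
  -- Both hexagons express the bilinearity of the exponent `x * y`.
  hexagon_forward x y z := by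
    apply val_ext
    simp only [val_comp, val_associator_hom, val_whiskerLeft, val_whiskerRight,
      val_koszul_hom, toNat_tensor, mul_one, one_mul, mul_add, pow_add]
  hexagon_reverse x y z := by
    apply val_ext
    simp only [val_comp, val_associator_inv, val_whiskerLeft, val_whiskerRight,
      val_koszul_hom, toNat_tensor, one_mul, add_mul, pow_add, mul_comm]
  symmetry x y := by
    apply val_ext
    simp only [val_comp, val_id, val_koszul_hom]
    rw [mul_comm (toNat y), ← sq, Int.units_sq]

end SignCat

/-! ### Signs of morphisms under a symmetric strict monoidal functor to `SignCat` -/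

namespace IsStrictSymmetric

open SignCat

variable {C : Type u} [Category.{v} C] [MonoidalCategory C] [SymmetricCategory C]
  {E : C ⥤ SignCat}

theorem toNat_tensor (hE : IsStrictSymmetric E) (x y : C) :
    toNat (E.obj (x ⊗ y)) = toNat (E.obj x) + toNat (E.obj y) := by
  rw [hE.obj_tensor]; rfl

theorem toNat_unit (hE : IsStrictSymmetric E) : toNat (E.obj (𝟙_ C)) = 0 := by
  rw [hE.obj_unit]; rfl

theorem val_tensor (hE : IsStrictSymmetric E) {x y x' y' : C} (s : x ⟶ y) (t : x' ⟶ y') :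
    val (E.map (s ⊗ₘ t)) = val (E.map s) * val (E.map t) :=
  val_heq (hE.obj_tensor _ _) (hE.obj_tensor _ _) (hE.map_tensor s t)

theorem val_whiskerLeft (hE : IsStrictSymmetric E) (x : C) {y z : C} (s : y ⟶ z) :
    val (E.map (x ◁ s)) = val (E.map s) := by
  rw [← id_tensorHom, hE.val_tensor, E.map_id, val_id, one_mul]

theorem val_whiskerRight (hE : IsStrictSymmetric E) {y z : C} (s : y ⟶ z) (x : C) :
    val (E.map (s ▷ x)) = val (E.map s) := by
  rw [← tensorHom_id, hE.val_tensor, E.map_id, val_id, mul_one]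

theorem val_braiding (hE : IsStrictSymmetric E) (x y : C) :
    val (E.map (β_ x y).hom) = (-1) ^ (toNat (E.obj x) * toNat (E.obj y)) :=
  val_heq (hE.obj_tensor _ _) (hE.obj_tensor _ _) (hE.map_braiding x y)

theorem val_map_comp (E : C ⥤ SignCat) {x y z : C} (s : x ⟶ y) (t : y ⟶ z) :
    val (E.map (s ≫ t)) = val (E.map s) * val (E.map t) :=
  congrArg val (E.map_comp s t)

/-- Every unit of `ℤ` is its own inverse. -/
theorem val_inv (E : C ⥤ SignCat) {x y : C} (e : x ≅ y) :
    val (E.map e.inv) = val (E.map e.hom) := by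
  have h : val (E.map e.hom) * val (E.map e.inv) = 1 := by
    rw [← val_comp, ← E.map_comp, e.hom_inv_id, E.map_id, val_id]
  rw [← mul_right_inj, h, Int.units_mul_self]

/-- In a strict monoidal category the structure isomorphisms are `eqToHom`s, and these carry no
sign. -/
theorem val_associator [StrictMonoidal C] (E : C ⥤ SignCat) (x y z : C) :
    val (E.map (α_ x y z).hom) = 1 := by
  rw [StrictMonoidal.associator_hom, eqToHom_map, val_eqToHom]

theorem val_leftUnitor [StrictMonoidal C] (E : C ⥤ SignCat) (x : C) :
    val (E.map (λ_ x).hom) = 1 := by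
  rw [StrictMonoidal.leftUnitor_hom, eqToHom_map, val_eqToHom]

theorem val_rightUnitor [StrictMonoidal C] (E : C ⥤ SignCat) (x : C) :
    val (E.map (ρ_ x).hom) = 1 := by
  rw [StrictMonoidal.rightUnitor_hom, eqToHom_map, val_eqToHom]

end IsStrictSymmetric

namespace SymPresentation

open SignCat

variable {p : SymPresentation.{u}} {E : p.Cat ⥤ SignCat}

theorem toNat_cons (hE : IsStrictSymmetric E) (l : p.Letter) (x : List p.Letter) :
    toNat (E.obj (l :: x : List p.Letter)) =
      toNat (E.obj ([l] : List p.Letter)) + toNat (E.obj x) :=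
  hE.toNat_tensor ([l] : List p.Letter) x

theorem even_of_letters (hE : IsStrictSymmetric E) {x : List p.Letter}
    (h : ∀ l ∈ x, Even (toNat (E.obj ([l] : List p.Letter)))) : Even (toNat (E.obj x)) := by
  induction x with
  | nil => exact ⟨0, hE.toNat_unit⟩
  | cons l x ih =>
    rw [toNat_cons hE]
    exact (h l (by simp)).add (ih fun l hl => h l (by simp [hl]))

/-- If all letters are even and all generating morphisms have sign `1`, then all morphisms have
sign `1`. -/
theorem val_eq_one (hE : IsStrictSymmetric E)
    (hl : ∀ l : p.Letter, Even (toNat (E.obj ([l] : List p.Letter))))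
    (hg : ∀ (x y : List p.Letter) (s : p.Gen x y), val (E.map (homMk (p := p) (.gen s))) = 1)
    {x y : p.Cat} (f : x ⟶ y) : val (E.map f) = 1 := by
  refine hom_induction (P := fun f => val (E.map f) = 1) (hg _ _)
    (fun x => congrArg val (E.map_id x)) ?_ ?_ ?_ f
  · intro _ _ _ s t hs ht
    rw [IsStrictSymmetric.val_map_comp, hs, ht, one_mul]
  · intro _ _ _ _ s t hs ht
    rw [hE.val_tensor, hs, ht, one_mul]
  · intro x y
    rw [hE.val_braiding]
    -- One even factor already makes the Koszul exponent even.
    exact ((even_of_letters hE fun l _ => hl l).mul_right _).neg_one_pow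

end SymPresentation

/-! ### Signs of doubling and quadrupling -/

section DoublingSigns

open SignCat Functor.LaxMonoidal

variable {A : Type u} [Category.{u} A] [MonoidalCategory A] [SymmetricCategory A]
  {E : A ⥤ SignCat}

theorem toNat_doubling (hE : IsStrictSymmetric E) (x : A) :
    toNat (E.obj ((doubling A).obj x)) = toNat (E.obj x) + toNat (E.obj x) :=
  hE.toNat_tensor x x

theorem even_doubling (hE : IsStrictSymmetric E) (x : A) :
    Even (toNat (E.obj ((doubling A).obj x))) :=
  ⟨_, toNat_doubling hE x⟩

theorem toNat_quadrupling (hE : IsStrictSymmetric E) (x : A) :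
    toNat (E.obj ((quadrupling A).obj x)) = 4 * toNat (E.obj x) := by
  change toNat (E.obj ((doubling A).obj ((doubling A).obj x))) = _
  rw [toNat_doubling hE, toNat_doubling hE]
  ring

/-- The sign of `s ⊗ s` is a square. -/
theorem val_doubling_map (hE : IsStrictSymmetric E) {x y : A} (s : x ⟶ y) :
    val (E.map ((doubling A).map s)) = 1 :=
  (hE.val_tensor s s).trans (Int.units_mul_self _)

variable [StrictMonoidal A]

/-- The middle exchange contains a single braiding, of `x` past `y`; all its other factors are
structure isomorphisms of sign 1. -/
theorem val_doubling_μ (hE : IsStrictSymmetric E) (x y : A) :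
    val (E.map (μ (doubling A) x y)) = (-1) ^ (toNat (E.obj x) * toNat (E.obj y)) := by
  refine (congrArg (fun s => val (E.map s)) (doubling_μ x y)).trans ?_
  change val (E.map (tensorμ x x y y)) = _
  simp only [tensorμ, Functor.map_comp, val_comp, hE.val_whiskerLeft, hE.val_whiskerRight,
    hE.val_braiding, IsStrictSymmetric.val_associator, IsStrictSymmetric.val_inv, one_mul,
    mul_one]

/-- This is where doubling twice matters: the first factor exchanges doubled, hence even, objects,
and the second is the double of a morphism. The constraint of doubling alone can have sign -1. -/
theorem val_quadrupling_μ (hE : IsStrictSymmetric E) (x y : A) :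
    val (E.map (μ (quadrupling A) x y)) = 1 := by
  refine (IsStrictSymmetric.val_map_comp E (μ (doubling A) _ _)
    ((doubling A).map (μ (doubling A) x y))).trans ?_
  rw [val_doubling_map hE, val_doubling_μ hE, mul_one]
  exact ((even_doubling hE x).mul_right _).neg_one_pow

theorem val_quadrupling_ε (hE : IsStrictSymmetric E) :
    val (E.map (ε (quadrupling A))) = 1 := by
  refine (IsStrictSymmetric.val_map_comp E (ε (doubling A))
    ((doubling A).map (ε (doubling A)))).trans ?_
  rw [val_doubling_map hE, mul_one]
  refine (congrArg (fun s => val (E.map s)) (doubling_ε A)).trans ?_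
  exact (IsStrictSymmetric.val_inv E _).trans (IsStrictSymmetric.val_leftUnitor E _)

/-- The Koszul exponent of one factor against three is `n * (3 * n)`, which has the parity of `n`.
-/
theorem val_cyclicBraiding (hE : IsStrictSymmetric E) (x : A) :
    val (E.map ((cyclicBraiding A).app x)) = (-1) ^ toNat (E.obj x) := by
  have h : val (E.map ((α_ x x (x ⊗ x)).hom ≫ (β_ x (x ⊗ (x ⊗ x))).hom ≫
      (α_ x (x ⊗ x) x).hom ≫ (x ◁ (α_ x x x).hom) ≫ (α_ x x (x ⊗ x)).inv)) =
      (-1) ^ (toNat (E.obj x) * (toNat (E.obj x) + (toNat (E.obj x) + toNat (E.obj x)))) := by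
    simp only [Functor.map_comp, val_comp, hE.val_whiskerLeft,
      hE.val_braiding, IsStrictSymmetric.val_associator, IsStrictSymmetric.val_inv, one_mul,
      mul_one, hE.toNat_tensor]
  refine h.trans ?_
  rcases Nat.even_or_odd (toNat (E.obj x)) with h | h
  · rw [(h.mul_right _).neg_one_pow, h.neg_one_pow]
  -- For odd `n`, the sum `n + (n + n)` is odd plus even, so the product with `n` is odd.
  · rw [(h.mul (h.add_even ⟨_, rfl⟩)).neg_one_pow, h.neg_one_pow]

end DoublingSigns

/-! ### Signs of `φ`-morphisms -/

section MateSigns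

open SignCat Functor.LaxMonoidal

variable {A : Type u} [Category.{u} A] [MonoidalCategory A] [SymmetricCategory A]
  [StrictMonoidal A] {B : Type u} [Category.{u} B] [MonoidalCategory B] [SymmetricCategory B]
  [StrictMonoidal B] {E : B ⥤ SignCat}

/-- A symmetric strong monoidal functor has trivial signs with respect to `E` if its objects are
even and its morphisms and constraints have sign `1`. -/
structure HasTrivialSigns (E : B ⥤ SignCat) (F : A ⥤ B) [F.Braided] : Prop where
  even : ∀ x, Even (toNat (E.obj (F.obj x)))
  map : ∀ {x y : A} (s : x ⟶ y), val (E.map (F.map s)) = 1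
  unit : val (E.map (ε F)) = 1
  mul : ∀ x y, val (E.map (μ F x y)) = 1

theorem hasTrivialSigns_quadrupling (hE : IsStrictSymmetric E) :
    HasTrivialSigns E (quadrupling B) where
  even x := by
    rw [toNat_quadrupling hE]
    exact (by decide : Even 4).mul_right _
  map s := val_doubling_map hE _
  unit := val_quadrupling_ε hE
  mul := val_quadrupling_μ hE

variable {F : A ⥤ B} [F.Braided]

theorem HasTrivialSigns.multComp (hF : HasTrivialSigns E F) :
    HasTrivialSigns E (Univ.multComp F) where
  even x := hF.even _
  map s := hF.map _
  unit := by
    -- With the same braided structure as in `multComp_braided`, the constraint of the composite is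
    -- by definition a constraint of `F` followed by the image under `F` of a morphism. Both have
    -- sign 1.
    let _ : (FreeSymm.mult A).Braided :=
      IsStrictSymmetric.braided (FreeSymm.lift_isStrictSymmetric _)
    have h : ε (Univ.multComp F) = ε F ≫ F.map (ε (FreeSymm.mult A)) := rfl
    rw [h, IsStrictSymmetric.val_map_comp, hF.map, hF.unit, one_mul]
  mul x y := by
    let _ : (FreeSymm.mult A).Braided :=
      IsStrictSymmetric.braided (FreeSymm.lift_isStrictSymmetric _)
    have h : μ (Univ.multComp F) x y = μ F _ _ ≫ F.map (μ (FreeSymm.mult A) x y) := rfl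
    rw [h, IsStrictSymmetric.val_map_comp, hF.map, hF.mul, one_mul]

/-- The iterated constraint is built from whiskerings of `ε` and `μ`, each of sign 1. -/
theorem HasTrivialSigns.bullet (hE : IsStrictSymmetric E) (hF : HasTrivialSigns E F)
    (x : List A) : val (E.map (PsClassifier.bullet F x).hom) = 1 := by
  induction x with
  | nil => exact hF.unit
  | cons a x ih =>
    refine (IsStrictSymmetric.val_map_comp E (F.obj a ◁ (PsClassifier.bullet F x).hom)
      (μ F a _)).trans ?_
    rw [hE.val_whiskerLeft, hF.mul, ih, one_mul]

theorem HasTrivialSigns.mateAdj (hE : IsStrictSymmetric E) (hF : HasTrivialSigns E F)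
    (x : List A) : val (E.map (PsClassifier.mateAdj F x).hom) = 1 := by
  change val (E.map ((PsClassifier.bullet F x).hom ≫ (ρ_ _).inv)) = 1
  rw [IsStrictSymmetric.val_map_comp, hF.bullet hE, IsStrictSymmetric.val_inv,
    IsStrictSymmetric.val_rightUnitor, one_mul]

theorem HasTrivialSigns.letter (hF : HasTrivialSigns E F) (a : A) :
    Even (toNat (E.obj (listProd F.obj [a]))) := by
  rw [PsClassifier.listProd_singleton]
  exact hF.even a

/-- The letters of `Q A` take the even values `F a`, so symmetries cost nothing and only generators
need checking. The free generators are themselves morphisms of the presented category `S A`, which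
calls for a second, inner use of `SymPresentation.val_eq_one`. -/
theorem HasTrivialSigns.mate (hE : IsStrictSymmetric E) (hF : HasTrivialSigns E F)
    {w v : PsClassifier A} (u : w ⟶ v) : val (E.map ((PsClassifier.mate F).map u)) = 1 := by
  refine SymPresentation.val_eq_one (p := psClassifierPresentation A)
    ((PsClassifier.mate_isStrictSymmetric F).comp hE) (hF.letter) ?_ u
  intro x y s
  cases s with
  | free t =>
    refine SymPresentation.val_eq_one (p := freeSymmCatPresentation A)
      ((FreeSymmCat.lift_isStrictSymmetric F).comp hE) (hF.letter) ?_ t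
    rintro _ _ ⟨s⟩
    refine (hE.val_tensor (F.map s) (𝟙 (𝟙_ B))).trans ?_
    rw [hF.map, E.map_id, val_id, one_mul]
  | adj x => exact hF.mateAdj hE x
  | adjInv => exact (IsStrictSymmetric.val_inv E _).trans (hF.mateAdj hE _)

end MateSigns

/-! ### Morphisms of `Q A` -/

namespace PsClassifier

section Full

variable {A : Type u} [Category.{u} A] [MonoidalCategory A] [SymmetricCategory A]
  [StrictMonoidal A]

theorem homMk_heq_of_rel {x y x' y' : List A} {f : SymTerm (PsClassifierGen A) x y}
    {g : SymTerm (PsClassifierGen A) x' y'} (h : PsClassifierRel A f g) :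
    HEq (SymPresentation.homMk (p := psClassifierPresentation A) f)
      (SymPresentation.homMk (p := psClassifierPresentation A) g) :=
  SymPresentation.homMk_heq (p := psClassifierPresentation A)
    (.of (rel_ends h).1 (rel_ends h).2 h)

variable (A) in
/-- The inclusion of the free morphisms. -/
def incl : FreeSymmCat A ⥤ PsClassifier A where
  obj x := x
  map t := SymPresentation.homMk (p := psClassifierPresentation A) (.gen (.free t))
  map_id x := eq_of_heq (homMk_heq_of_rel (.free_id x))
  map_comp s t := eq_of_heq (homMk_heq_of_rel (.free_comp s t))

variable (A) in
theorem incl_isStrictSymmetric : IsStrictSymmetric (incl A) where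
  obj_unit := rfl
  obj_tensor _ _ := rfl
  map_tensor s t := homMk_heq_of_rel (.free_tensor s t)
  map_braiding x y := homMk_heq_of_rel (.free_braiding x y)

variable (A) in
/-- The inclusion of `A` as one-entry tuples. -/
def single : A ⥤ PsClassifier A where
  obj a := tuple [a]
  map s := (incl A).map (FreeSymmCat.unitMap s)
  map_id a := (congrArg (incl A).map (eq_of_heq (SymPresentation.homMk_heq
    (p := freeSymmCatPresentation A) (.of rfl rfl (.mor_id a))))).trans ((incl A).map_id _)
  map_comp s t := by
    have h : FreeSymmCat.unitMap (s ≫ t) = FreeSymmCat.unitMap s ≫ FreeSymmCat.unitMap t :=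
      eq_of_heq (SymPresentation.homMk_heq (p := freeSymmCatPresentation A)
        (.of rfl rfl (.mor_comp s t)))
    exact (congrArg (incl A).map h).trans ((incl A).map_comp _ _)

/-- The product of the entries of a tuple. -/
abbrev total (x : PsClassifier A) : A := (FreeSymmCat.mult A).obj x

/-- The adjoined isomorphisms. -/
def adj (x : PsClassifier A) : x ≅ (single A).obj (total x) where
  hom := SymPresentation.homMk (p := psClassifierPresentation A) (.gen (.adj x))
  inv := SymPresentation.homMk (p := psClassifierPresentation A) (.gen (.adjInv x))
  hom_inv_id := eq_of_heq (homMk_heq_of_rel (.adj_adjInv x))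
  inv_hom_id := eq_of_heq (homMk_heq_of_rel (.adjInv_adj x))

theorem adj_naturality {x y : FreeSymmCat A} (t : x ⟶ y) :
    (incl A).map t ≫ (adj y).hom =
      (adj x).hom ≫ (single A).map ((FreeSymmCat.mult A).map t) :=
  eq_of_heq (homMk_heq_of_rel (.adj_natural t))

theorem total_append (x y : PsClassifier A) : total (x ⊗ y) = total x ⊗ total y :=
  listProd_append _ _ _

theorem total_single (a : A) : total ((single A).obj a) = a :=
  StrictMonoidal.tensor_unit a

/-- This is the normality relation `q_(x) = 1`. The `eqToHom` only accounts for the total of a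
one-entry tuple being `a ⊗ 𝟙_ A`. -/
theorem adj_single (a : A) :
    (adj ((single A).obj a)).hom = (single A).map (eqToHom (total_single a).symm) := by
  rw [eqToHom_map]
  exact eq_of_heq ((homMk_heq_of_rel (.adj_normal a)).trans
    (StrictMonoidal.heq_eqToHom (Y := (single A).obj a) _ rfl).symm)

theorem adj_tensor_left (x z : PsClassifier A) :
    HEq (((adj x).hom ⊗ₘ 𝟙 z) ≫ (adj ((single A).obj (total x) ⊗ z)).hom)
      (adj (x ⊗ z)).hom := by
  -- The associativity relation with empty middle block speaks of `x ++ []`, which equals `x` only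
  -- propositionally; generalizing over `y` allows the transport.
  have h : ∀ y : PsClassifier A, List.append x [] = y →
      HEq (((adj y).hom ⊗ₘ 𝟙 z) ≫ (adj ((single A).obj (total y) ⊗ z)).hom)
        (adj (y ⊗ z)).hom := by
    rintro _ rfl
    exact homMk_heq_of_rel (.adj_assoc_left x [] z)
  exact h x (List.append_nil x)

theorem adj_tensor_right (x z : PsClassifier A) :
    HEq ((𝟙 x ⊗ₘ (adj z).hom) ≫ (adj (x ⊗ (single A).obj (total z))).hom)
      (adj (x ⊗ z)).hom :=
  homMk_heq_of_rel (.adj_assoc_right x [] z)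

theorem total_tensor_single (x z : PsClassifier A) :
    total ((single A).obj (total x) ⊗ (single A).obj (total z)) = total (x ⊗ z) := by
  rw [total_append, total_append, total_single, total_single]

/-- Associativity of `q`, used once on each side: collapsing a concatenation amounts to collapsing
both blocks and then the resulting pair. -/
theorem adj_tensor (x z : PsClassifier A) :
    (adj (x ⊗ z)).hom = ((adj x).hom ⊗ₘ (adj z).hom) ≫
      (adj ((single A).obj (total x) ⊗ (single A).obj (total z))).hom ≫
        (single A).map (eqToHom (total_tensor_single x z)) := by
  have h : ((adj x).hom ⊗ₘ (adj z).hom) =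
      ((adj x).hom ⊗ₘ 𝟙 z) ≫ (𝟙 _ ⊗ₘ (adj z).hom) := by
    rw [tensorHom_comp_tensorHom, Category.comp_id, Category.id_comp]
  apply eq_of_heq
  rw [h, eqToHom_map]
  simp only [← Category.assoc]
  refine HEq.trans ?_ (comp_eqToHom_heq _ _).symm
  rw [Category.assoc]
  refine (adj_tensor_left x z).symm.trans ?_
  refine StrictMonoidal.heq_comp' rfl rfl (congrArg (single A).obj ?_) HEq.rfl
    (adj_tensor_right _ z).symm
  rw [total_append, total_append, total_single (total z)]

/-- A product of two free morphisms is free, so naturality of `q` applies to it; `r` is its image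
under the multiplication. -/
theorem single_tensor_naturality {a b c d : A} (s : a ⟶ b) (t : c ⟶ d) :
    ∃ r, ((single A).map s ⊗ₘ (single A).map t) ≫
        (adj ((single A).obj b ⊗ (single A).obj d)).hom =
      (adj ((single A).obj a ⊗ (single A).obj c)).hom ≫ (single A).map r :=
  ⟨_, (congrArg (· ≫ (adj _).hom) (eq_of_heq ((incl_isStrictSymmetric A).map_tensor
    (FreeSymmCat.unitMap s) (FreeSymmCat.unitMap t)))).symm.trans (adj_naturality _)⟩

/-- The symmetry of two one-entry tuples is a free morphism, so naturality of `q` applies again. -/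
theorem single_braiding_naturality (a b : A) :
    ∃ r, (β_ ((single A).obj a) ((single A).obj b)).hom ≫
        (adj ((single A).obj b ⊗ (single A).obj a)).hom =
      (adj ((single A).obj a ⊗ (single A).obj b)).hom ≫ (single A).map r :=
  ⟨_, (congrArg (· ≫ (adj _).hom) (eq_of_heq ((incl_isStrictSymmetric A).map_braiding
    (FreeSymmCat.tuple [a]) (FreeSymmCat.tuple [b])))).symm.trans (adj_naturality _)⟩

/-- Both sides are identities, the right one by normality. -/
theorem adj_inv_conj (x : PsClassifier A) :
    (adj x).inv ≫ (adj x).hom = (adj ((single A).obj (total x))).hom ≫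
      (single A).map (eqToHom (total_single (total x))) := by
  rw [adj_single, ← CategoryTheory.Functor.map_comp, eqToHom_trans, eqToHom_refl,
    CategoryTheory.Functor.map_id, Iso.inv_hom_id]

/-- Every morphism of `Q A` is conjugate to a morphism of `A` by adjoined isomorphisms. -/
theorem exists_adj_conj {x y : PsClassifier A} (u : x ⟶ y) :
    ∃ s, u ≫ (adj y).hom = (adj x).hom ≫ (single A).map s := by
  refine SymPresentation.hom_induction (p := psClassifierPresentation A)
    (P := fun {x y} u => ∃ s, u ≫ (adj y).hom = (adj x).hom ≫ (single A).map s)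
    ?_ ?_ ?_ ?_ ?_ u
  · intro x y g
    cases g with
    | free t => exact ⟨_, adj_naturality t⟩
    -- The target of `q` is already a one-entry tuple, where the adjoined isomorphism is an
    -- `eqToHom`.
    | adj => exact ⟨_, congrArg ((adj (A := A) x).hom ≫ ·) (adj_single _)⟩
    | adjInv => exact ⟨_, adj_inv_conj y⟩
  · intro x
    exact ⟨𝟙 _, by rw [CategoryTheory.Functor.map_id, Category.comp_id, Category.id_comp]⟩
  · rintro x y z f g ⟨s, hs⟩ ⟨t, ht⟩
    exact ⟨s ≫ t, by rw [CategoryTheory.Functor.map_comp, Category.assoc, ht, ← Category.assoc,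
      hs, Category.assoc]⟩
  · rintro x y x' y' f g ⟨s, hs⟩ ⟨t, ht⟩
    obtain ⟨r, hr⟩ := single_tensor_naturality s t
    refine ⟨eqToHom (total_tensor_single x x').symm ≫ r ≫
      eqToHom (total_tensor_single y y'), ?_⟩
    -- Collapse the two blocks separately, apply the hypotheses blockwise, and then move the
    -- resulting pair of one-entry morphisms past the last `q`.
    rw [adj_tensor y y', ← Category.assoc, tensorHom_comp_tensorHom, hs, ht,
      ← tensorHom_comp_tensorHom, Category.assoc, reassoc_of% hr, adj_tensor x x']
    simp [← CategoryTheory.Functor.map_comp]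
  · intro x y
    obtain ⟨r, hr⟩ := single_braiding_naturality (total x) (total y)
    refine ⟨eqToHom (total_tensor_single x y).symm ≫ r ≫
      eqToHom (total_tensor_single y x), ?_⟩
    rw [adj_tensor y x, ← Category.assoc, ← BraidedCategory.braiding_naturality, Category.assoc,
      reassoc_of% hr, adj_tensor x y]
    simp [← CategoryTheory.Functor.map_comp]

end Full

end PsClassifier

/-! ### Fullness of `ζ♭` -/

section ZetaFull

variable {G : Type u}

variable (G) in
/-- The symmetric strict monoidal functor `S G ⥤ S (S G)` sending a tuple `⟨aᵢ⟩ᵢ` to the tuple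
`⟨(aᵢ)⟩ᵢ` of one-entry tuples. -/
def singletons : FreeSymm G ⥤ FreeSymmCat (FreeSymm G) :=
  FreeSymm.lift fun a => FreeSymmCat.tuple [FreeSymm.tuple [a]]

/-- Both functors are strict on a free category and agree on letters. The factorization shows that
the image of `ζ♭` consists of free morphisms, to which naturality of `q` applies. -/
theorem zetaFlat_map_heq {x y : FreeSymm G} (t : x ⟶ y) :
    HEq ((zetaFlat G).map t) ((PsClassifier.incl (FreeSymm G)).map ((singletons G).map t)) :=
  SymPresentation.map_heq_of_letters (p := freeSymmPresentation G)
    (F := zetaFlat G) (G := singletons G ⋙ PsClassifier.incl (FreeSymm G))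
    (FreeSymm.lift_isStrictSymmetric _)
    ((FreeSymm.lift_isStrictSymmetric _).comp (PsClassifier.incl_isStrictSymmetric _))
    (fun _ => rfl) (fun _ _ s => PEmpty.elim s) t

theorem singletons_obj (x : FreeSymm G) : (singletons G).obj x = (zetaFlat G).obj x :=
  SymPresentation.obj_eq_of_letters (p := freeSymmPresentation G)
    (F := singletons G ⋙ PsClassifier.incl (FreeSymm G)) (G := zetaFlat G)
    ((FreeSymm.lift_isStrictSymmetric _).comp (PsClassifier.incl_isStrictSymmetric _))
    (FreeSymm.lift_isStrictSymmetric _) (fun _ => rfl) x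

/-- A unit law: splitting a tuple into one-entry tuples and multiplying gives back the identity
functor, again because strict functors on `S G` are determined by letters. -/
theorem mult_singletons_map_heq {x y : FreeSymm G} (t : x ⟶ y) :
    HEq ((FreeSymmCat.mult (FreeSymm G)).map ((singletons G).map t)) t :=
  SymPresentation.map_heq_of_letters (p := freeSymmPresentation G)
    (F := singletons G ⋙ FreeSymmCat.mult (FreeSymm G)) (G := 𝟭 (FreeSymm G))
    ((FreeSymm.lift_isStrictSymmetric _).comp (FreeSymmCat.lift_isStrictSymmetric _))
    { obj_unit := rfl
      obj_tensor := fun _ _ => rfl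
      map_tensor := fun _ _ => HEq.rfl
      map_braiding := fun _ _ => HEq.rfl }
    (fun _ => rfl) (fun _ _ s => PEmpty.elim s) t

theorem mult_singletons_obj (x : FreeSymm G) :
    (FreeSymmCat.mult (FreeSymm G)).obj ((singletons G).obj x) = x :=
  SymPresentation.obj_eq_of_letters (p := freeSymmPresentation G)
    (F := singletons G ⋙ FreeSymmCat.mult (FreeSymm G)) (G := 𝟭 (FreeSymm G))
    ((FreeSymm.lift_isStrictSymmetric _).comp (FreeSymmCat.lift_isStrictSymmetric _))
    { obj_unit := rfl
      obj_tensor := fun _ _ => rfl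
      map_tensor := fun _ _ => HEq.rfl
      map_braiding := fun _ _ => HEq.rfl }
    (fun _ => rfl) x

/-- The functor `S G ⥤ Q (S G)` sending `⟨aᵢ⟩ᵢ` to `⟨(aᵢ)⟩ᵢ` is full. -/
theorem singletons_incl_full {x y : FreeSymm G}
    (u : (PsClassifier.incl (FreeSymm G)).obj ((singletons G).obj x) ⟶
      (PsClassifier.incl (FreeSymm G)).obj ((singletons G).obj y)) :
    ∃ t : x ⟶ y, (PsClassifier.incl (FreeSymm G)).map ((singletons G).map t) = u := by
  obtain ⟨s, hs⟩ := PsClassifier.exists_adj_conj u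
  -- The morphism `s` runs between totals of tuples of singletons, which are `x` and `y` themselves.
  let t : x ⟶ y := eqToHom (mult_singletons_obj x).symm ≫ s ≫ eqToHom (mult_singletons_obj y)
  refine ⟨t, ?_⟩
  -- After composition with the isomorphism `q` of the target, both morphisms become `q` of the
  -- source followed by the same morphism of `S G`.
  rw [← cancel_mono (PsClassifier.adj _).hom, hs]
  refine (PsClassifier.adj_naturality _).trans (congrArg _ (congrArg _ ?_))
  exact eq_of_heq ((mult_singletons_map_heq t).trans (StrictMonoidal.conj_heq _ _ _))

/-- The functor `ζ♭ : S G ⥤ Q (S G)` is full. -/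
theorem zetaFlat_full {x y : FreeSymm G} (u : (zetaFlat G).obj x ⟶ (zetaFlat G).obj y) :
    ∃ t : x ⟶ y, (zetaFlat G).map t = u := by
  obtain ⟨t, ht⟩ := singletons_incl_full (x := x) (y := y)
    (eqToHom (singletons_obj x) ≫ u ≫ eqToHom (singletons_obj y).symm)
  exact ⟨t, eq_of_heq ((zetaFlat_map_heq t).trans
    ((heq_of_eq ht).trans (StrictMonoidal.conj_heq _ _ _)))⟩

end ZetaFull

/-! ### Products of generating morphisms -/

section Generating

variable {A : Type u} {φ : A → A}

/-- The letters of an object of `S(ob A, φ)`. -/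
abbrev letters (x : Univ φ) : List (UnivLetter A A) := x

theorem mem_letters_tensor {x y : Univ φ} {l : UnivLetter A A} :
    l ∈ letters (x ⊗ y) ↔ l ∈ letters x ∨ l ∈ letters y :=
  List.mem_append

/-- An object is free if all its letters are. -/
def IsFree (x : Univ φ) : Prop := ∀ l ∈ letters x, ∃ c, l = .free c

theorem isFree_tensor {x y : Univ φ} : IsFree (x ⊗ y) ↔ IsFree x ∧ IsFree y := by
  simp only [IsFree, mem_letters_tensor, or_imp, forall_and]

theorem IsFree.exists_kappa {x : Univ φ} (h : IsFree x) :
    ∃ x₀ : FreeSymm A, (Univ.kappa φ).obj x₀ = x := by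
  have key : ∀ y : List (UnivLetter A A), (∀ l ∈ y, ∃ c, l = .free c) →
      ∃ y₀ : List A, y₀.map .free = y := by
    intro y hy
    induction y with
    | nil => exact ⟨[], rfl⟩
    | cons l y ih =>
      obtain ⟨c, rfl⟩ := hy l (by simp)
      obtain ⟨y₀, rfl⟩ := ih fun l hl => hy l (by simp [hl])
      exact ⟨c :: y₀, rfl⟩
  exact key x h

theorem kappa_obj_injective : Function.Injective (Univ.kappa φ).obj :=
  List.map_injective_iff.mpr fun _ _ h => UnivLetter.free.inj h

/-- The letter `[φ]w` is identified with a free letter only when `w` has length one, so a free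
`φ`-object is indexed by a tuple of one-entry tuples. -/
theorem exists_zetaFlat {w : PsClassifier (FreeSymm A)}
    (h : IsFree ((Univ.phiHat φ).obj w)) : ∃ z : FreeSymm A, (zetaFlat A).obj z = w := by
  have key : ∀ v : List (List A), (∀ l ∈ v.map (phiLetter φ), ∃ c, l = .free c) →
      ∃ z : List A, (zetaFlat A).obj z = v := by
    intro v hv
    induction v with
    | nil => exact ⟨[], rfl⟩
    | cons x v ih =>
      obtain ⟨z, hz⟩ := ih fun l hl => hv l (by simp [hl])
      obtain ⟨c, hc⟩ := hv (phiLetter φ x) (by simp)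
      match x, hc with
      | [a], _ => exact ⟨a :: z, congrArg (List.cons [a]) hz⟩
  exact key w h

/-- A morphism lifts to a free morphism if it is the image under `κ` of a morphism of
`S(ob A)`, up to equality of its end points. -/
def LiftsToKappa {x y : Univ φ} (s : x ⟶ y) : Prop :=
  ∃ (x₀ y₀ : FreeSymm A) (t : x₀ ⟶ y₀), (Univ.kappa φ).obj x₀ = x ∧
    (Univ.kappa φ).obj y₀ = y ∧ HEq ((Univ.kappa φ).map t) s

/-- Since `κ` is injective on objects, the end points of a lift can be prescribed. This allows
separately lifted morphisms to be composed. -/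
theorem LiftsToKappa.exists_map {x y : Univ φ} {s : x ⟶ y} (h : LiftsToKappa s)
    {x₀ y₀ : FreeSymm A} (hx : (Univ.kappa φ).obj x₀ = x) (hy : (Univ.kappa φ).obj y₀ = y) :
    ∃ t : x₀ ⟶ y₀, (Univ.kappa φ).map t = eqToHom hx ≫ s ≫ eqToHom hy.symm := by
  obtain ⟨x₁, y₁, t, hx', hy', ht⟩ := h
  obtain rfl := kappa_obj_injective (hx.trans hx'.symm)
  obtain rfl := kappa_obj_injective (hy.trans hy'.symm)
  exact ⟨t, eq_of_heq (ht.trans (StrictMonoidal.conj_heq _ _ _).symm)⟩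

theorem LiftsToKappa.tensor {x y x' y' : Univ φ} {s : x ⟶ y} {t : x' ⟶ y'}
    (hs : LiftsToKappa s) (ht : LiftsToKappa t) : LiftsToKappa (s ⊗ₘ t) := by
  obtain ⟨x₀, y₀, s₀, rfl, rfl, hs⟩ := hs
  obtain ⟨x₁, y₁, t₀, rfl, rfl, ht⟩ := ht
  obtain rfl := eq_of_heq hs
  obtain rfl := eq_of_heq ht
  have h := Univ.kappa_isStrictSymmetric φ
  exact ⟨_, _, s₀ ⊗ₘ t₀, h.obj_tensor _ _, h.obj_tensor _ _, h.map_tensor _ _⟩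

variable [Category.{u} A] [MonoidalCategory A]

/-- Symmetries of `;` only permute the letters, so any condition imposed on each letter separately
is invariant under formal morphisms. -/
theorem IsFormal.perm {x y : Univ φ} {s : x ⟶ y} (hs : IsFormal s) :
    (letters x).Perm (letters y) := by
  induction hs with
  | id x => exact .refl _
  | braiding x y => exact List.perm_append_comm
  | comp _ _ ih₁ ih₂ => exact ih₁.trans ih₂
  | tensor _ _ ih₁ ih₂ => exact ih₁.append ih₂

theorem IsFormal.isFree_iff {x y : Univ φ} {s : x ⟶ y} (hs : IsFormal s) :
    IsFree x ↔ IsFree y :=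
  forall_congr' fun _ => imp_congr_left hs.perm.mem_iff

theorem IsFormal.of_heq {x y x' y' : Univ φ} {s : x ⟶ y} {t : x' ⟶ y'} (hx : x = x')
    (hy : y = y') (h : HEq s t) (hs : IsFormal s) : IsFormal t := by
  subst hx hy
  rwa [← eq_of_heq h]

/-- The category `S(ob A)` has no generating morphisms, so its morphisms are built from symmetries,
which `κ` preserves. Parity and sign statements for free morphisms thus reduce to formal ones. -/
theorem isFormal_kappa {x y : FreeSymm A} (t : x ⟶ y) : IsFormal ((Univ.kappa φ).map t) := by
  have hk := Univ.kappa_isStrictSymmetric φ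
  refine SymPresentation.hom_induction (p := freeSymmPresentation A)
    (P := fun t => IsFormal ((Univ.kappa φ).map t)) (fun s => PEmpty.elim s) ?_ ?_ ?_ ?_ t
  · intro x
    rw [CategoryTheory.Functor.map_id]
    exact .id _
  · intro _ _ _ s t hs ht
    rw [CategoryTheory.Functor.map_comp]
    exact .comp hs ht
  · intro _ _ _ _ s t hs ht
    exact .of_heq (hk.obj_tensor _ _).symm (hk.obj_tensor _ _).symm (hk.map_tensor s t).symm
      (.tensor hs ht)
  · intro x y
    exact .of_heq (hk.obj_tensor _ _).symm (hk.obj_tensor _ _).symm (hk.map_braiding x y).symm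
      (.braiding _ _)

theorem IsFormal.liftsToKappa {x y : Univ φ} {s : x ⟶ y} (hs : IsFormal s) (hx : IsFree x) :
    LiftsToKappa s := by
  have hk := Univ.kappa_isStrictSymmetric φ
  induction hs with
  | id x =>
    obtain ⟨x₀, rfl⟩ := hx.exists_kappa
    exact ⟨x₀, x₀, 𝟙 x₀, rfl, rfl, heq_of_eq ((Univ.kappa φ).map_id x₀)⟩
  | braiding x y =>
    obtain ⟨hx, hy⟩ := isFree_tensor.mp hx
    obtain ⟨x₀, rfl⟩ := hx.exists_kappa
    obtain ⟨y₀, rfl⟩ := hy.exists_kappa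
    exact ⟨_, _, (β_ x₀ y₀).hom, hk.obj_tensor _ _, hk.obj_tensor _ _, hk.map_braiding _ _⟩
  | comp hs ht ih₁ ih₂ =>
    obtain ⟨x₀, y₀, s₀, rfl, rfl, hs₀⟩ := ih₁ hx
    -- The intermediate object is free because its letters are a permutation of those of the source.
    obtain ⟨y₁, z₀, t₀, hy, rfl, ht₀⟩ := ih₂ (hs.isFree_iff.mp hx)
    obtain rfl := kappa_obj_injective hy
    obtain rfl := eq_of_heq hs₀
    obtain rfl := eq_of_heq ht₀
    exact ⟨_, _, s₀ ≫ t₀, rfl, rfl, heq_of_eq ((Univ.kappa φ).map_comp _ _)⟩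
  | tensor hs ht ih₁ ih₂ =>
    obtain ⟨hx, hy⟩ := isFree_tensor.mp hx
    exact (ih₁ hx).tensor (ih₂ hy)

/-- Products of generating morphisms between free objects are free. -/
theorem IsProductOfGenerating.liftsToKappa {x y : Univ φ} {s : x ⟶ y}
    (hs : IsProductOfGenerating s) (hx : IsFree x) (hy : IsFree y) : LiftsToKappa s := by
  induction hs with
  | gen hs =>
    cases hs with
    | free t => exact ⟨_, _, t, rfl, rfl, HEq.rfl⟩
    | phi u =>
      -- Both ends come from `ζ♭`, so by fullness the `φ`-morphism does too, and the pushout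
      -- relation rewrites it as a free morphism.
      obtain ⟨z, rfl⟩ := exists_zetaFlat hx
      obtain ⟨z', rfl⟩ := exists_zetaFlat hy
      obtain ⟨t, rfl⟩ := zetaFlat_full u
      exact ⟨_, _, (FreeSymm.map φ).map t, Univ.map_free_map φ z, Univ.map_free_map φ z',
        Univ.homMk_heq_of_rel φ (.pushout t)⟩
    | formal hs => exact hs.liftsToKappa hx
  | tensor hs ht ih₁ ih₂ =>
    obtain ⟨hx, hx'⟩ := isFree_tensor.mp hx
    obtain ⟨hy, hy'⟩ := isFree_tensor.mp hy
    exact (ih₁ hx hy).tensor (ih₂ hx' hy')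

end Generating

/-! ### Signs of products of generating morphisms -/

section GeneratingSigns

open SignCat

variable {A : Type u} [Category.{u} A] [MonoidalCategory A] [SymmetricCategory A]
  [StrictMonoidal A] {F : A ⥤ A} [F.Braided] {E : A ⥤ SignCat}

/-- An object of `S(ob A, F_ob)` is even if all its letters have even values under `E`. -/
def EvenLetters (E : A ⥤ SignCat) (x : Univ F.obj) : Prop :=
  ∀ l ∈ letters x, Even (toNat (E.obj (Univ.lamLetter F l)))

theorem evenLetters_tensor {x y : Univ F.obj} :
    EvenLetters E (x ⊗ y) ↔ EvenLetters E x ∧ EvenLetters E y := by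
  simp only [EvenLetters, mem_letters_tensor, or_imp, forall_and]

theorem lam_obj_singleton (l : UnivLetter A A) :
    (Univ.lam F).obj (show Univ F.obj from [l]) = Univ.lamLetter F l :=
  PsClassifier.listProd_singleton _ _

theorem EvenLetters.even (hE : IsStrictSymmetric E) {x : Univ F.obj} (hx : EvenLetters E x) :
    Even (toNat (E.obj ((Univ.lam F).obj x))) := by
  refine SymPresentation.even_of_letters (p := univPresentation F.obj)
    ((Univ.lam_isStrictSymmetric F).comp hE) fun l hl => ?_
  change Even (toNat (E.obj ((Univ.lam F).obj (show Univ F.obj from [l]))))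
  rw [lam_obj_singleton]
  exact hx l hl

theorem IsFormal.evenLetters_iff {x y : Univ F.obj} {s : x ⟶ y} (hs : IsFormal s) :
    EvenLetters E x ↔ EvenLetters E y :=
  forall_congr' fun _ => imp_congr_left hs.perm.mem_iff

/-- Words with even letters have even value under `Λ`, so every symmetry that occurs exchanges even
blocks. The condition has to be letterwise to pass to the factors of a product. -/
theorem IsFormal.val_eq_one (hE : IsStrictSymmetric E) {x y : Univ F.obj} {s : x ⟶ y}
    (hs : IsFormal s) (hx : EvenLetters E x) : val (E.map ((Univ.lam F).map s)) = 1 := by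
  have hL := (Univ.lam_isStrictSymmetric F).comp hE
  induction hs with
  | id x => exact congrArg val ((Univ.lam F ⋙ E).map_id x)
  | braiding x y =>
    refine (hL.val_braiding x y).trans ?_
    exact (((evenLetters_tensor.mp hx).1.even hE).mul_right _).neg_one_pow
  | @comp _ _ _ s t hs ht ih₁ ih₂ =>
    refine (IsStrictSymmetric.val_map_comp (Univ.lam F ⋙ E) s t).trans ?_
    exact (congrArg₂ (· * ·) (ih₁ hx) (ih₂ (hs.evenLetters_iff.mp hx))).trans (one_mul 1)
  | @tensor _ _ _ _ s t hs ht ih₁ ih₂ =>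
    refine (hL.val_tensor s t).trans ?_
    obtain ⟨hx, hy⟩ := evenLetters_tensor.mp hx
    exact (congrArg₂ (· * ·) (ih₁ hx) (ih₂ hy)).trans (one_mul 1)

/-- Each letter `[φ]v` has value `F` of the sum of `v`, also when `v` has length one and the letter
counts as free. -/
theorem evenLetters_phiHat (hF : HasTrivialSigns E F) (w : PsClassifier (FreeSymm A)) :
    EvenLetters E ((Univ.phiHat F.obj).obj w) := by
  intro l hl
  obtain ⟨v, -, rfl⟩ := List.mem_map.mp hl
  rw [Univ.lamLetter_phiLetter]
  exact hF.even _

/-- Free and formal morphisms permute letters, while both ends of a `φ`-morphism are always even.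
The equivalence is needed in both senses: evenness spreads forward for the sign computation, and so
does failure of evenness for balanced objects. -/
theorem IsProductOfGenerating.evenLetters_iff (hF : HasTrivialSigns E F) {x y : Univ F.obj}
    {s : x ⟶ y} (hs : IsProductOfGenerating s) : EvenLetters E x ↔ EvenLetters E y := by
  induction hs with
  | gen hs =>
    cases hs with
    | free t => exact (isFormal_kappa t).evenLetters_iff
    | phi u => exact iff_of_true (evenLetters_phiHat hF _) (evenLetters_phiHat hF _)
    | formal hs => exact hs.evenLetters_iff
  | tensor _ _ ih₁ ih₂ => rw [evenLetters_tensor, evenLetters_tensor, ih₁, ih₂]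

theorem IsProductOfGenerating.val_eq_one (hE : IsStrictSymmetric E) (hF : HasTrivialSigns E F)
    {x y : Univ F.obj} {s : x ⟶ y} (hs : IsProductOfGenerating s) (hx : EvenLetters E x) :
    val (E.map ((Univ.lam F).map s)) = 1 := by
  have hL := (Univ.lam_isStrictSymmetric F).comp hE
  induction hs with
  | gen hs =>
    cases hs with
    | free t => exact (isFormal_kappa t).val_eq_one hE hx
    | phi u =>
      -- Up to equality of end points, `Λ` on a `φ`-morphism is the mate of the composite `multComp
      -- F`, which has trivial signs along with `F`.
      exact (val_heq (congrArg E.obj (Univ.lam_phi F _)) (congrArg E.obj (Univ.lam_phi F _))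
        (IsStrictSymmetric.map_heq E (Univ.lam_phi F _) (Univ.lam_phi F _)
          (Univ.lamGen_phi F u))).trans (hF.multComp.mate hE u)
    | formal hs => exact hs.val_eq_one hE hx
  | @tensor _ _ _ _ s t _ _ ih₁ ih₂ =>
    refine (hL.val_tensor s t).trans ?_
    obtain ⟨hx, hy⟩ := evenLetters_tensor.mp hx
    exact (congrArg₂ (· * ·) (ih₁ hx) (ih₂ hy)).trans (one_mul 1)

/-! ### Signs of tidy composites -/

theorem IsTidyComposite.evenLetters_iff_zero (hF : HasTrivialSigns E F) {r : ℕ}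
    {K : ComposableArrows (Univ F.obj) r} (hK : IsTidyComposite K) (i : ℕ) (hi : i ≤ r) :
    EvenLetters E (K.obj' i) ↔ EvenLetters E (K.obj' 0) := by
  induction i with
  | zero => rfl
  | succ i ih => exact ((hK.map i hi).evenLetters_iff hF).symm.trans (ih (by omega))

theorem IsTidyComposite.val_map_zero (hE : IsStrictSymmetric E) (hF : HasTrivialSigns E F)
    {r : ℕ} {K : ComposableArrows (Univ F.obj) r} (hK : IsTidyComposite K)
    (h : EvenLetters E (K.obj' 0)) (i : ℕ) (hi : i ≤ r) :
    val (E.map ((Univ.lam F).map (K.map' 0 i))) = 1 := by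
  induction i with
  | zero =>
    exact (congrArg (fun s => val (E.map ((Univ.lam F).map s))) (K.map'_self 0)).trans
      (congrArg val ((Univ.lam F ⋙ E).map_id _))
  | succ i ih =>
    rw [K.map'_comp 0 i (i + 1)]
    refine (IsStrictSymmetric.val_map_comp (Univ.lam F ⋙ E) _ _).trans ?_
    exact (congrArg₂ (· * ·) (ih (by omega)) ((hK.map i hi).val_eq_one hE hF
      ((hK.evenLetters_iff_zero hF i (by omega)).mpr h))).trans (one_mul 1)

end GeneratingSigns

/-! ### Counting letters -/

section Letters

open SignCat

/-- The number of occurrences of the letter `c` in the letter `d`. -/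
def TwoLetters.indicator : TwoLetters → TwoLetters → ℕ
  | .a, .a => 1
  | .b, .b => 1
  | _, _ => 0

/-- The symmetric strict monoidal functor counting the letter `c`, and recording the sign of the
permutation of its occurrences. -/
def letterSign (c : TwoLetters) : FreeTwo ⥤ SignCat :=
  FreeSymm.lift (C := SignCat) fun d => c.indicator d

theorem letterSign_isStrictSymmetric (c : TwoLetters) : IsStrictSymmetric (letterSign c) :=
  FreeSymm.lift_isStrictSymmetric _

/-- The number of occurrences of `c` in `x`. -/
def letterCount (c : TwoLetters) (x : FreeTwo) : ℕ := toNat ((letterSign c).obj x)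

theorem letterCount_tensor (c : TwoLetters) (x y : FreeTwo) :
    letterCount c (x ⊗ y) = letterCount c x + letterCount c y :=
  (letterSign_isStrictSymmetric c).toNat_tensor x y

theorem letterCount_quadrupling (c : TwoLetters) (x : FreeTwo) :
    letterCount c ((quadrupling FreeTwo).obj x) = 4 * letterCount c x :=
  toNat_quadrupling (letterSign_isStrictSymmetric c) x

/-- The single, odd occurrence of each generator in `a + b` is the source of the sign -1 in the
diagram. -/
theorem letterCount_add (c : TwoLetters) :
    letterCount c FreeTwo.a + letterCount c FreeTwo.b = 1 := by
  cases c <;> rfl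

theorem exists_letterCount_pos {x : FreeTwo} (hx : x ≠ 𝟙_ FreeTwo) :
    ∃ c, 0 < letterCount c x := by
  match x, hx with
  | [], h => exact absurd rfl h
  | d :: x, _ =>
    refine ⟨d, ?_⟩
    have h : letterCount d (d :: x : List TwoLetters) = d.indicator d + letterCount d x := rfl
    rw [h]
    exact Nat.add_pos_left (by cases d <;> exact Nat.one_pos) _

/-- All morphisms of `SignCat` are endomorphisms, so counts are invariant under morphisms. -/
theorem eq_of_hom_letterCount {x y : FreeTwo} (s : x ⟶ y) (c : TwoLetters) :
    letterCount c x = letterCount c y :=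
  congrArg toNat (eq_of_hom ((letterSign c).map s))

/-- Tuples with trivial product have trivial entries. -/
theorem eq_replicate_of_mult {G : Type u} (w : List (FreeSymm G))
    (hw : (FreeSymm.mult (FreeSymm G)).obj (FreeSymm.tuple w) = 𝟙_ (FreeSymm G)) :
    w = List.replicate w.length (𝟙_ (FreeSymm G)) := by
  induction w with
  | nil => rfl
  | cons v w ih =>
    -- The product is concatenation of words, and a concatenation is empty only if both parts are.
    obtain ⟨hv, hw⟩ := List.append_eq_nil_iff.mp
      (show List.append v ((FreeSymm.mult (FreeSymm G)).obj (FreeSymm.tuple w)) = [] from hw)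
    exact congrArg₂ List.cons hv (ih hw)

end Letters

/-! ### Tidy objects -/

section TidyObjects

open SignCat

/-- The objects of `S(ob A, φ)`, where `φ` is quadrupling. -/
abbrev QuadUniv : Type := Univ (quadrupling FreeTwo).obj

/-- The functor `Λ` for quadrupling. -/
abbrev quadLam : QuadUniv ⥤ FreeTwo := Univ.lam (quadrupling FreeTwo)

/-- An object is balanced if its value under `Λ` consists of four copies of each letter, while some
of its letters have an odd number of occurrences of each. -/
structure IsBalanced (x : QuadUniv) : Prop where
  count : ∀ c, letterCount c (quadLam.obj x) = 4
  odd : ∀ c, ¬ EvenLetters (F := quadrupling FreeTwo) (letterSign c) x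

theorem letterCount_le (c : TwoLetters) {x : QuadUniv} {l : UnivLetter FreeTwo FreeTwo}
    (hl : l ∈ letters x) :
    letterCount c (Univ.lamLetter (quadrupling FreeTwo) l) ≤ letterCount c (quadLam.obj x) := by
  have key : ∀ y : List (UnivLetter FreeTwo FreeTwo), l ∈ y →
      letterCount c (Univ.lamLetter (quadrupling FreeTwo) l) ≤
        letterCount c (listProd (Univ.lamLetter (quadrupling FreeTwo)) y) := by
    intro y hy
    induction y with
    | nil => cases hy
    | cons d y ih =>
      have h : letterCount c (listProd (Univ.lamLetter (quadrupling FreeTwo)) (d :: y)) = _ :=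
        letterCount_tensor c _ _
      rw [h]
      rcases List.mem_cons.mp hy with rfl | hy
      · exact Nat.le_add_right _ _
      · exact (ih hy).trans (Nat.le_add_left _ _)
  exact key x hl

theorem phiLetter_of_length_ne {G G' : Type u} (φ : G → G') (w : List G) (h : w.length ≠ 1) :
    phiLetter φ w = .phi w h := by
  match w, h with
  | [], _ => rfl
  | [_], h => exact absurd rfl h
  | _ :: _ :: _, _ => rfl

/-- A tuple with zero sum consists of zeros, so its letter would be exactly a factor `[φ](0, …, 0)`.
This is the only use of tidiness of objects. -/
theorem IsTidy.mult_ne {x : QuadUniv} (hx : IsTidy x) {w : List FreeTwo} {h : w.length ≠ 1}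
    (hw : UnivLetter.phi w h ∈ letters x) :
    (FreeSymm.mult FreeTwo).obj (FreeSymm.tuple w) ≠ 𝟙_ FreeTwo := by
  intro h0
  obtain ⟨y, z, hyz⟩ := List.append_of_mem hw
  refine hx w.length y z (hyz.trans (congrArg (y ++ ·) ?_))
  refine congrArg (· :: z) ?_
  rw [← phiLetter_of_length_ne (quadrupling FreeTwo).obj w h]
  exact congrArg (phiLetter (quadrupling FreeTwo).obj) (eq_replicate_of_mult w h0)

/-- Balanced tidy objects are free. -/
theorem IsTidy.isFree {x : QuadUniv} (hx : IsTidy x) (hb : IsBalanced x) : IsFree x := by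
  intro l hl
  match l, hl with
  | .free c, _ => exact ⟨c, rfl⟩
  | .phi w h, hl =>
    exfalso
    -- The generator `c` is any one occurring in the sum of `w`; it depends on the letter, which is
    -- why balance is required for both generators.
    obtain ⟨c, hc⟩ := exists_letterCount_pos (hx.mult_ne hl)
    obtain ⟨y, z, hyz⟩ := List.append_of_mem hl
    have hL : letterCount c (Univ.lamLetter (quadrupling FreeTwo) (.phi w h)) = _ :=
      letterCount_quadrupling c _
    let y' : QuadUniv := y
    let z' : QuadUniv := z
    have hsum : letterCount c (quadLam.obj x) = letterCount c (quadLam.obj y') +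
        (letterCount c (Univ.lamLetter (quadrupling FreeTwo) (.phi w h)) +
          letterCount c (quadLam.obj z')) := by
      refine (congrArg (fun x => letterCount c
        (listProd (Univ.lamLetter (quadrupling FreeTwo)) x)) hyz).trans ?_
      rw [listProd_append, letterCount_tensor]
      exact congrArg _ (letterCount_tensor c _ _)
    -- Now `4 = p + (4 * k + q)` with `k > 0`, which forces `k = 1` and `p = q = 0`: the letter
    -- `[φ]w` exhausts the occurrences of `c`, and all letters are even in `c`.
    rw [hb.count, hL] at hsum
    refine hb.odd c fun l' hl' => ?_
    change Even (letterCount c _)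
    rw [show letters x = _ from hyz, List.mem_append, List.mem_cons] at hl'
    rcases hl' with hl' | rfl | hl'
    · have := letterCount_le c (x := y') hl'
      rw [show letterCount c _ = 0 by omega]
      exact Even.zero
    · rw [hL]
      exact (by decide : Even 4).mul_right _
    · have := letterCount_le c (x := z') hl'
      rw [show letterCount c _ = 0 by omega]
      exact Even.zero

theorem hasTrivialSigns (c : TwoLetters) :
    HasTrivialSigns (letterSign c) (quadrupling FreeTwo) :=
  hasTrivialSigns_quadrupling (letterSign_isStrictSymmetric c)

/-- Counts are transported by `Λ` of any morphism; only the parity condition needs information about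
`s`. -/
theorem IsBalanced.of_map {x y : QuadUniv} (hx : IsBalanced x) (s : x ⟶ y)
    (h : ∀ c, EvenLetters (F := quadrupling FreeTwo) (letterSign c) y ↔
      EvenLetters (F := quadrupling FreeTwo) (letterSign c) x) : IsBalanced y where
  count c := (eq_of_hom_letterCount (quadLam.map s) c).symm.trans (hx.count c)
  odd c := mt (h c).mp (hx.odd c)

/-- A tidy composite that starts at a balanced object is free. -/
theorem IsTidyComposite.exists_kappa {r : ℕ} {K : ComposableArrows QuadUniv r}
    (hK : IsTidyComposite K) (h0 : IsBalanced (K.obj' 0)) :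
    ∃ K' : ComposableArrows (FreeSymm FreeTwo) r,
      K' ⋙ Univ.kappa (quadrupling FreeTwo).obj = K := by
  have hfree : ∀ i, IsFree (K.obj i) := fun i =>
    (hK.obj i).isFree (h0.of_map (K.map' 0 i) fun c =>
      hK.evenLetters_iff_zero (hasTrivialSigns c) i (Nat.le_of_lt_succ i.isLt))
  choose obj hobj using fun i => (hfree i).exists_kappa
  -- Each step is lifted between the object lifts already chosen, so that consecutive lifts compose.
  choose map hmap using fun i : Fin r =>
    ((hK.map i i.isLt).liftsToKappa (hfree _) (hfree _)).exists_map (hobj i.castSucc)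
      (hobj i.succ)
  refine ⟨ComposableArrows.mkOfObjOfMapSucc obj map, ComposableArrows.ext hobj fun i hi => ?_⟩
  refine Eq.trans ?_ (hmap ⟨i, hi⟩)
  exact congrArg (Univ.kappa _).map (ComposableArrows.mkOfObjOfMapSucc_map_succ obj map i hi)

theorem HasTidyFactorization.evenLetters_iff {x y : QuadUniv} {s : x ⟶ y}
    (hs : HasTidyFactorization s) (c : TwoLetters) :
    EvenLetters (F := quadrupling FreeTwo) (letterSign c) y ↔
      EvenLetters (F := quadrupling FreeTwo) (letterSign c) x := by
  obtain ⟨r, K, hK, h⟩ := hs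
  obtain rfl : K.left = x := congrArg Arrow.leftFunc.obj h
  obtain rfl : K.right = y := congrArg Arrow.rightFunc.obj h
  exact hK.evenLetters_iff_zero (hasTrivialSigns c) r le_rfl

theorem HasTidyFactorization.val_eq_one {x y : QuadUniv} {s : x ⟶ y}
    (hs : HasTidyFactorization s) (c : TwoLetters)
    (hx : EvenLetters (F := quadrupling FreeTwo) (letterSign c) x) :
    val ((letterSign c).map (quadLam.map s)) = 1 := by
  obtain ⟨r, K, hK, h⟩ := hs
  obtain rfl : K.left = x := congrArg Arrow.leftFunc.obj h
  obtain rfl : K.right = y := congrArg Arrow.rightFunc.obj h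
  obtain rfl : K.hom = s := (Arrow.mk_inj _ _).mp h
  exact hK.val_map_zero (letterSign_isStrictSymmetric c) (hasTrivialSigns c) hx r le_rfl

theorem HasTidyFactorization.liftsToKappa {x y : QuadUniv} {s : x ⟶ y}
    (hs : HasTidyFactorization s) (hx : IsBalanced x) : LiftsToKappa s := by
  obtain ⟨r, K, hK, h⟩ := hs
  obtain rfl : K.left = x := congrArg Arrow.leftFunc.obj h
  obtain rfl : K.right = y := congrArg Arrow.rightFunc.obj h
  obtain rfl : K.hom = s := (Arrow.mk_inj _ _).mp h
  obtain ⟨K', rfl⟩ := hK.exists_kappa hx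
  exact ⟨_, _, K'.hom, rfl, rfl, HEq.rfl⟩

end TidyObjects

/-! ### The signs of the monoidal naturality diagram -/

section DiagramSigns

open SignCat

theorem letterCount_topLeft (c : TwoLetters) :
    letterCount c (natDiagramObj FreeTwo.a FreeTwo.b .topLeft) = 4 := by
  refine (letterCount_tensor c _ _).trans ?_
  rw [letterCount_quadrupling, letterCount_quadrupling, ← mul_add, letterCount_add]

theorem val_top (c : TwoLetters) :
    val ((letterSign c).map (natDiagramMap FreeTwo.a FreeTwo.b .top)) = -1 := by
  have hE := letterSign_isStrictSymmetric c
  refine (hE.val_tensor ((cyclicBraiding FreeTwo).app FreeTwo.a)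
    ((cyclicBraiding FreeTwo).app FreeTwo.b)).trans ?_
  rw [val_cyclicBraiding hE, val_cyclicBraiding hE, ← pow_add]
  exact (congrArg ((-1) ^ ·) (letterCount_add c)).trans (pow_one _)

theorem val_bot (c : TwoLetters) :
    val ((letterSign c).map (natDiagramMap FreeTwo.a FreeTwo.b .bot)) = -1 := by
  refine (val_cyclicBraiding (letterSign_isStrictSymmetric c) _).trans ?_
  exact (congrArg ((-1) ^ ·) ((letterCount_tensor c _ _).trans (letterCount_add c))).trans
    (pow_one _)

theorem val_μ_doubling (c : TwoLetters) :
    val ((letterSign c).map (Functor.LaxMonoidal.μ (doubling FreeTwo)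
      ((doubling FreeTwo).obj FreeTwo.a) ((doubling FreeTwo).obj FreeTwo.b))) = 1 := by
  have hE := letterSign_isStrictSymmetric c
  rw [val_doubling_μ hE]
  exact ((even_doubling hE _).mul_right _).neg_one_pow

theorem val_natLeftBottom (c : TwoLetters) :
    val ((letterSign c).map (natLeftBottom FreeTwo.a FreeTwo.b)) = -1 := by
  have hE := letterSign_isStrictSymmetric c
  have h₁ := val_μ_doubling c
  have h₂ := val_doubling_map hE (Functor.LaxMonoidal.μ (doubling FreeTwo) FreeTwo.a FreeTwo.b)
  refine (IsStrictSymmetric.val_map_comp _ _ _).trans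
    ((congrArg₂ (· * ·) h₁ ((IsStrictSymmetric.val_map_comp _ _ _).trans
      (congrArg₂ (· * ·) h₂ (val_bot c)))).trans ?_)
  rw [one_mul, one_mul]

theorem val_natTopRight (c : TwoLetters) :
    val ((letterSign c).map (natTopRight FreeTwo.a FreeTwo.b)) = -1 := by
  have hE := letterSign_isStrictSymmetric c
  have h₁ := val_μ_doubling c
  have h₂ := val_doubling_map hE (Functor.LaxMonoidal.μ (doubling FreeTwo) FreeTwo.a FreeTwo.b)
  refine (IsStrictSymmetric.val_map_comp _ _ _).trans
    ((congrArg₂ (· * ·) (val_top c) ((IsStrictSymmetric.val_map_comp _ _ _).trans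
      (congrArg₂ (· * ·) h₁ h₂))).trans ?_)
  rw [mul_one, mul_one]

/-- If all letters at the start were even in `c`, the composite would have sign 1 instead of -1. -/
theorem IsTidyComposite.isBalanced {r : ℕ} {K : ComposableArrows QuadUniv r}
    (hK : IsTidyComposite K) {y : FreeTwo} {s : natDiagramObj FreeTwo.a FreeTwo.b .topLeft ⟶ y}
    (hs : ∀ c, val ((letterSign c).map s) = -1)
    (h : Arrow.mk (quadLam.map K.hom) = Arrow.mk s) : IsBalanced K.left where
  count c := (congrArg (letterCount c) (congrArg Arrow.leftFunc.obj h)).trans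
    (letterCount_topLeft c)
  odd c hc := by
    have h₁ := hK.val_map_zero (letterSign_isStrictSymmetric c) (hasTrivialSigns c) hc r le_rfl
    have h₂ := congrArg (fun f : Arrow FreeTwo => val ((letterSign c).map f.hom)) h
    have h₃ : (1 : ℤˣ) = -1 := h₁.symm.trans (h₂.trans (hs c))
    exact absurd h₃ (by decide)

/-- Functors that agree have maps that agree up to equality of their end points. -/
theorem functor_map_heq {C : Type u₁} [Category.{v₁} C] {D : Type u₂} [Category.{v₂} D]
    {F G : C ⥤ D} (h : F = G) {x y : C} (s : x ⟶ y) : HEq (F.map s) (G.map s) := by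
  subst h; rfl

/-! ### Lifting the whole diagram, and the main theorem -/

theorem exists_lift_natDiagram (D : Paths NatVertex ⥤ QuadUniv)
    (hD : D ⋙ quadLam = natDiagram FreeTwo.a FreeTwo.b)
    (ht : ∀ (x y : NatVertex) (e : x ⟶ y), HasTidyFactorization (D.map e.toPath)) :
    ∃ D' : Paths NatVertex ⥤ FreeSymm FreeTwo,
      D' ⋙ Univ.kappa (quadrupling FreeTwo).obj = D ∧
        D' ⋙ FreeSymm.mult FreeTwo = natDiagram FreeTwo.a FreeTwo.b := by
  have hobj : ∀ v : NatVertex, quadLam.obj (D.obj v) = natDiagramObj FreeTwo.a FreeTwo.b v :=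
    fun v => congrArg (fun K : Paths NatVertex ⥤ FreeTwo => K.obj v) hD
  have hbal : IsBalanced (D.obj NatVertex.topLeft) :=
    { count := fun c => (congrArg (letterCount c) (hobj _)).trans (letterCount_topLeft c)
      odd := fun c hc => by
        -- The top edge alone has sign -1, which already rules out even letters at its source.
        have h₁ := (ht _ _ NatEdge.top).val_eq_one c hc
        have h₂ : HEq (quadLam.map (D.map (Quiver.Hom.toPath NatEdge.top)))
            (natDiagramMap FreeTwo.a FreeTwo.b .top) :=
          (functor_map_heq hD _).trans (heq_of_eq (Paths.lift_toPath _ _))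
        have h₃ := val_heq (congrArg (letterSign c).obj (hobj _))
          (congrArg (letterSign c).obj (hobj _))
          (IsStrictSymmetric.map_heq (letterSign c) (hobj _) (hobj _) h₂)
        have h₄ : (1 : ℤˣ) = -1 := h₁.symm.trans (h₃.trans (val_top c))
        exact absurd h₄ (by decide) }
  have step : ∀ {x y : NatVertex} (e : x ⟶ y), IsBalanced (D.obj x) → IsBalanced (D.obj y) :=
    fun e hx => hx.of_map (D.map e.toPath) (ht _ _ e).evenLetters_iff
  -- Every vertex is reached from the top left one by edges, along which balance propagates.
  have hall : ∀ v : NatVertex, IsBalanced (D.obj v) := by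
    intro v
    cases v with
    | topLeft => exact hbal
    | midLeft => exact step NatEdge.left₁ hbal
    | botLeft => exact step NatEdge.left₂ (step NatEdge.left₁ hbal)
    | topRight => exact step NatEdge.top hbal
    | midRight => exact step NatEdge.right₁ (step NatEdge.top hbal)
    | botRight => exact step NatEdge.right₂ (step NatEdge.right₁ (step NatEdge.top hbal))
  have hlift : ∀ {x y : NatVertex} (e : x ⟶ y), LiftsToKappa (D.map e.toPath) :=
    fun e => (ht _ _ e).liftsToKappa (hall _)
  -- Every vertex except the bottom right one is the source of an edge, so its lift is read off from
  -- a source; the remaining one is the target of the bottom edge.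
  have hex : ∀ v : NatVertex, ∃ x₀, (Univ.kappa (quadrupling FreeTwo).obj).obj x₀ = D.obj v := by
    have hl : ∀ {x y : NatVertex} (_ : x ⟶ y),
        ∃ x₀, (Univ.kappa (quadrupling FreeTwo).obj).obj x₀ = D.obj x := fun e => by
      obtain ⟨x₀, -, -, h, -, -⟩ := hlift e
      exact ⟨x₀, h⟩
    intro v
    cases v with
    | topLeft => exact hl NatEdge.top
    | midLeft => exact hl NatEdge.left₂
    | botLeft => exact hl NatEdge.bot
    | topRight => exact hl NatEdge.right₁
    | midRight => exact hl NatEdge.right₂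
    | botRight =>
      obtain ⟨-, y₀, -, -, h, -⟩ := hlift NatEdge.bot
      exact ⟨y₀, h⟩
  choose obj hobj' using hex
  choose map hmap using fun (x y : NatVertex) (e : x ⟶ y) =>
    (hlift e).exists_map (hobj' x) (hobj' y)
  let D' : Paths NatVertex ⥤ FreeSymm FreeTwo :=
    Paths.lift { obj := obj, map := fun e => map _ _ e }
  have hD' : D' ⋙ Univ.kappa (quadrupling FreeTwo).obj = D :=
    -- Functors on a free category are compared on vertices and single edges.
    Paths.ext_functor (funext hobj') fun x y e =>
      (congrArg (Univ.kappa _).map (Paths.lift_toPath _ e)).trans (hmap x y e)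
  refine ⟨D', hD', ?_⟩
  -- The sum functor is `Λκ`, so the second identity follows from the first and from `D` being a
  -- lift.
  rw [← Univ.kappa_lam (quadrupling FreeTwo), ← Functor.assoc, hD', hD]

end DiagramSigns

theorem mainTheorem10 :
    (∀ (r : ℕ) (F : ComposableArrows (Univ (quadrupling FreeTwo).obj) r), IsTidyComposite F →
      (Arrow.mk ((Univ.lam (quadrupling FreeTwo)).map F.hom) =
          Arrow.mk (natLeftBottom FreeTwo.a FreeTwo.b) ∨
        Arrow.mk ((Univ.lam (quadrupling FreeTwo)).map F.hom) =
          Arrow.mk (natTopRight FreeTwo.a FreeTwo.b)) →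
      ∃ F' : ComposableArrows (FreeSymm FreeTwo) r,
        F' ⋙ Univ.kappa (quadrupling FreeTwo).obj = F) ∧
    (∀ D : Paths NatVertex ⥤ Univ (quadrupling FreeTwo).obj,
      D ⋙ Univ.lam (quadrupling FreeTwo) = natDiagram FreeTwo.a FreeTwo.b →
      (∀ (x y : NatVertex) (e : x ⟶ y), HasTidyFactorization (D.map e.toPath)) →
      ∃ D' : Paths NatVertex ⥤ FreeSymm FreeTwo,
        D' ⋙ Univ.kappa (quadrupling FreeTwo).obj = D ∧
          D' ⋙ FreeSymm.mult FreeTwo = natDiagram FreeTwo.a FreeTwo.b) := by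
  refine ⟨fun r F hF h => hF.exists_kappa ?_, exists_lift_natDiagram⟩
  rcases h with h | h
  · exact hF.isBalanced val_natLeftBottom h
  · exact hF.isBalanced val_natTopRight h
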